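/- Let $w\in\mathfrak S_n$ be a permutation, written in one-line notation, such that $\{w(1),\dots,w(r)\}\neq\{1,\dots,r\}$ for all $1\le r<n$. Elnitsky's polygon $X(w)$ is the equilateral $2n$-gon whose sides are labeled $1,\dots,n,w(n),\dots,w(1)$ in counterclockwise order starting from the top vertex, where the first $n$ sides (the leftside boundary) form half of a convex $2n$-gon and sides with the same label are parallel; the sides labeled $w(1),\dots,w(n)$, from the top vertex to the bottom vertex, form the rightside boundary. A rhombic tiling of $X(w)$ is a tiling by rhombi whose edges are congruent and parallel to sides of $X(w)$; the labels of a tile are the labels of the sides to which its edges are parallel. A tile is a right-perimeter tile if it shares two consecutive edges with the rightside boundary of $X(w)$, and it is a forced right-perimeter tile for $w$ if it appears, as a right-perimeter tile, in every rhombic tiling of $X(w)$. Suppose that $x=w(k)$ and $y=w(k+1)$ are adjacent entries of $w$ with $x>y$. Then the following are equivalent: 1. there is a forced right-perimeter tile for $w$ with labels $\{x,y\}$; 2. $x$ and $y$ do not occur together in a $321$-pattern of $w$, i.e. there are no positions $a<b<c$ with $w(a)>w(b)>w(c)$ and $x,y\in\{w(a),w(b),w(c)\}$; 3. $x$ is a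 left-to-right maximum of $w$ (larger than every entry to its left) and $y$ is a right-to-left minimum of $w$ (smaller than every entry to its right). -/

import Mathlib

noncomputable section

namespace Elnitsky

/-- The unit edge vector with label `i`, of direction angle `θ i`. -/
def edgeVec {n : ℕ} (θ : Fin n → ℝ) (i : Fin n) : ℂ :=
  Complex.exp ((θ i : ℂ) * Complex.I)

/-- Admissible direction angles: the edges, in the order of their labels, all point downwards and
turn strictly counterclockwise. Starting from the top vertex and following the edge vectors
`0, 1, …, n - 1` one then traces half of a convex equilateral `2n`-gon, on its left side. -/
structure IsAdmissible {n : ℕ} (θ : Fin n → ℝ) : Prop where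
  strictMono : StrictMono θ
  mem_Ioo : ∀ i, θ i ∈ Set.Ioo Real.pi (2 * Real.pi)

/-- The `k`-th vertex of the descending path that starts at the top vertex `0` and whose successive
edges have the labels `σ 0, σ 1, …, σ (n - 1)`. -/
def pathVertex {n : ℕ} (θ : Fin n → ℝ) (σ : Equiv.Perm (Fin n)) (k : ℕ) : ℂ :=
  ∑ i ∈ Finset.univ.filter (fun i : Fin n => (i : ℕ) < k), edgeVec θ (σ i)

/-- The `k`-th edge (counted from `0` at the top) of that path, a segment with label `σ k`. -/
def pathEdge {n : ℕ} (θ : Fin n → ℝ) (σ : Equiv.Perm (Fin n)) (k : ℕ) : Set ℂ :=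
  segment ℝ (pathVertex θ σ k) (pathVertex θ σ (k + 1))

/-- The whole path, as a set of points. -/
def path {n : ℕ} (θ : Fin n → ℝ) (σ : Equiv.Perm (Fin n)) : Set ℂ :=
  ⋃ k : Fin n, pathEdge θ σ k

/-- The leftside boundary of `X(w)`: labels `0, 1, …, n - 1` from top to bottom. -/
def leftBoundary {n : ℕ} (θ : Fin n → ℝ) : Set ℂ := path θ (Equiv.refl (Fin n))

/-- The rightside boundary of `X(w)`: labels `w 0, w 1, …, w (n - 1)` from top to bottom. -/
def rightBoundary {n : ℕ} (θ : Fin n → ℝ) (w : Equiv.Perm (Fin n)) : Set ℂ := path θ w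

/-- Elnitsky's polygon `X(w)`, as a closed region. Both boundary paths descend strictly from the
top vertex to the bottom vertex, so the region they enclose consists of the points lying
horizontally between a point of the leftside and a point of the rightside boundary. -/
def polygon {n : ℕ} (θ : Fin n → ℝ) (w : Equiv.Perm (Fin n)) : Set ℂ :=
  {p | ∃ l ∈ leftBoundary θ, ∃ r ∈ rightBoundary θ w,
    l.im = p.im ∧ r.im = p.im ∧ l.re ≤ p.re ∧ p.re ≤ r.re}

/-- A rhombic tile: its top vertex, at any point of the plane, and the two distinct labels of its
edges, the smaller one first. -/
structure Tile (n : ℕ) where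
  top : ℂ
  lo : Fin n
  hi : Fin n
  lo_lt_hi : lo < hi

/-- The labels of a tile. -/
def Tile.labels {n : ℕ} (t : Tile n) : Finset (Fin n) := {t.lo, t.hi}

/-- The closed rhombus occupied by a tile. -/
def Tile.carrier {n : ℕ} (θ : Fin n → ℝ) (t : Tile n) : Set ℂ :=
  {p | ∃ a ∈ Set.Icc (0 : ℝ) 1, ∃ b ∈ Set.Icc (0 : ℝ) 1,
    p = t.top + a • edgeVec θ t.lo + b • edgeVec θ t.hi}

/-- The four edges of a tile. -/
def Tile.edges {n : ℕ} (θ : Fin n → ℝ) (t : Tile n) : Set (Set ℂ) :=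
  {segment ℝ t.top (t.top + edgeVec θ t.lo),
   segment ℝ t.top (t.top + edgeVec θ t.hi),
   segment ℝ (t.top + edgeVec θ t.lo) (t.top + edgeVec θ t.lo + edgeVec θ t.hi),
   segment ℝ (t.top + edgeVec θ t.hi) (t.top + edgeVec θ t.lo + edgeVec θ t.hi)}

/-- `T` is a rhombic tiling of `X(w)`: its tiles do not overlap and together fill `X(w)`. -/
structure IsRhombicTiling {n : ℕ} (θ : Fin n → ℝ) (w : Equiv.Perm (Fin n))
    (T : Finset (Tile n)) : Prop where
  nonoverlapping : ∀ s ∈ T, ∀ t ∈ T, s ≠ t →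
    Disjoint (interior (s.carrier θ)) (interior (t.carrier θ))
  covers : (⋃ t ∈ T, t.carrier θ) = polygon θ w

/-- The tile `t` shares two consecutive edges with the rightside boundary of `X(w)`. -/
def Tile.IsRightPerimeter {n : ℕ} (θ : Fin n → ℝ) (w : Equiv.Perm (Fin n)) (t : Tile n) : Prop :=
  ∃ k : ℕ, k + 1 < n ∧ pathEdge θ w k ∈ t.edges θ ∧ pathEdge θ w (k + 1) ∈ t.edges θ

/-- The tile `t` appears as a right-perimeter tile in every rhombic tiling of `X(w)`. -/
def Tile.IsForcedRightPerimeter {n : ℕ} (θ : Fin n → ℝ) (w : Equiv.Perm (Fin n))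
    (t : Tile n) : Prop :=
  ∀ T : Finset (Tile n), IsRhombicTiling θ w T → t ∈ T ∧ t.IsRightPerimeter θ w

/-- There is a forced right-perimeter tile with labels `{x, y}` for `w`. -/
def HasForcedRightPerimeterTile {n : ℕ} (θ : Fin n → ℝ) (w : Equiv.Perm (Fin n))
    (x y : Fin n) : Prop :=
  ∃ t : Tile n, t.labels = {x, y} ∧ t.IsForcedRightPerimeter θ w

/-- `w` does not map `{0, …, r - 1}` onto itself for any `0 < r < n`. -/
def FullySupported {n : ℕ} (w : Equiv.Perm (Fin n)) : Prop :=
  ∀ r : ℕ, 0 < r → r < n →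
    w '' {i : Fin n | (i : ℕ) < r} ≠ {i : Fin n | (i : ℕ) < r}

/-- The values `x` and `y` occur together in some `321`-pattern of `w`. -/
def TogetherIn321 {n : ℕ} (w : Equiv.Perm (Fin n)) (x y : Fin n) : Prop :=
  ∃ a b c : Fin n, a < b ∧ b < c ∧ w c < w b ∧ w b < w a ∧
    x ∈ ({w a, w b, w c} : Set (Fin n)) ∧ y ∈ ({w a, w b, w c} : Set (Fin n))

/-- The value `x` is a left-to-right maximum of `w`. -/
def IsLRMax {n : ℕ} (w : Equiv.Perm (Fin n)) (x : Fin n) : Prop :=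
  ∃ k : Fin n, w k = x ∧ ∀ j : Fin n, j < k → w j < x

/-- The value `y` is a right-to-left minimum of `w`. -/
def IsRLMin {n : ℕ} (w : Equiv.Perm (Fin n)) (y : Fin n) : Prop :=
  ∃ k : Fin n, w k = y ∧ ∀ j : Fin n, k < j → y < w j

end Elnitsky

end

noncomputable section

namespace Elnitsky

open Finset

/-! All edges point downwards, so the two boundary paths and the two sides of every tile are graphs
over the height, and geometric claims become inequalities between piecewise linear functions.
Exchanging a descent of `w` at positions `a`, `a + 1` moves the rightside boundary inwards across
exactly one rhombus, `descentTile`; adding or removing this rhombus links tilings for `w` and for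
`exchange w a ha`. The exchanged permutation need not be fully supported, and its boundary paths may
run together along edges that no tile covers. Inductions therefore use `IsWeakTiling`, which for
fully supported `w` is equivalent to `IsRhombicTiling`.

Forced tiles: a nonempty tiling has a rightmost tile, whose right side lies on the boundary, so it
is a descent tile (`IsWeakTiling.exists_descentTile_mem`). If `x = w k` is a left-to-right maximum
and `y = w (k + 1)` a right-to-left minimum, there is no descent at `k - 1` or `k + 1`. Peeling off
a descent tile other than that of `k` thus preserves `x`, `y` and both conditions. While this
descent persists, some area remains to be covered, so its own tile must occur.

Avoidable tiles: a larger entry before `x` can be carried down by exchanges until it is exchanged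
with `x` itself. The tile then lying along the edge of `x` has `x` as its smaller label, hence is
not the tile of `{x, y}`. Smaller entries after `y` are treated symmetrically. The equivalence with
`321`-patterns is pure combinatorics (`not_togetherIn321_iff`). -/

/-! ### Ramps and the two sides of a rhombus -/

/-- The piecewise linear function that rises from `0` to `1` on `[0, s]`. -/
def ramp (s u : ℝ) : ℝ := max 0 (min 1 (u / s))

theorem ramp_of_nonpos {s u : ℝ} (hs : 0 < s) (hu : u ≤ 0) : ramp s u = 0 := by
  have : u / s ≤ 0 := div_nonpos_of_nonpos_of_nonneg hu hs.le
  exact max_eq_left (min_le_of_right_le this)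

theorem ramp_of_ge {s u : ℝ} (hs : 0 < s) (hu : s ≤ u) : ramp s u = 1 := by
  have : 1 ≤ u / s := (one_le_div hs).2 hu
  rw [ramp, min_eq_left this, max_eq_right zero_le_one]

theorem ramp_of_mem {s u : ℝ} (hs : 0 < s) (h0 : 0 ≤ u) (hu : u ≤ s) : ramp s u = u / s := by
  rw [ramp, min_eq_right ((div_le_one hs).2 hu), max_eq_right (div_nonneg h0 hs.le)]

theorem continuous_ramp (s : ℝ) : Continuous (ramp s) := by
  unfold ramp; fun_prop

/-- Horizontal displacement after descending by `u` along an edge with vertical extent `s` and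
horizontal extent `c`, followed by an edge with extents `s'` and `c'`. -/
def bend (s c s' c' u : ℝ) : ℝ := ramp s u * c + ramp s' (u - s) * c'

theorem continuous_bend (s c s' c' : ℝ) : Continuous (bend s c s' c') := by
  have h1 := continuous_ramp s
  have h2 := continuous_ramp s'
  unfold bend; fun_prop

theorem bend_of_le {s c s' c' u : ℝ} (hs : 0 < s) (hs' : 0 < s') (h0 : 0 ≤ u) (hu : u ≤ s) :
    bend s c s' c' u = u / s * c := by
  rw [bend, ramp_of_mem hs h0 hu, ramp_of_nonpos hs' (by linarith)]; ring

theorem bend_of_ge {s c s' c' u : ℝ} (hs : 0 < s) (hs' : 0 < s') (h0 : s ≤ u)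
    (hu : u ≤ s + s') : bend s c s' c' u = c + (u - s) / s' * c' := by
  rw [bend, ramp_of_ge hs h0, ramp_of_mem hs' (by linarith) (by linarith)]; ring

theorem bend_of_nonpos {s c s' c' u : ℝ} (hs : 0 < s) (hs' : 0 < s') (hu : u ≤ 0) :
    bend s c s' c' u = 0 := by
  rw [bend, ramp_of_nonpos hs hu, ramp_of_nonpos hs' (by linarith)]; ring

theorem bend_of_ge_add {s c s' c' u : ℝ} (hs : 0 < s) (hs' : 0 < s') (hu : s + s' ≤ u) :
    bend s c s' c' u = c + c' := by
  rw [bend, ramp_of_ge hs (by linarith), ramp_of_ge hs' (by linarith)]; ring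

/-- A point `a • (c, s) + b • (c', s')` lies weakly to the right of the bent path that starts with
`(c, s)` if and only if `a ≤ 1` and `0 ≤ b`, provided that `(c, s)` points further left. -/
theorem bend_le_iff {s c s' c' a b : ℝ} (hs : 0 < s) (hs' : 0 < s') (hc : c * s' < c' * s)
    (h0 : 0 ≤ a * s + b * s') (hu : a * s + b * s' ≤ s + s') :
    bend s c s' c' (a * s + b * s') ≤ a * c + b * c' ↔ a ≤ 1 ∧ 0 ≤ b := by
  rcases le_total (a * s + b * s') s with h | h
  · rw [bend_of_le hs hs' h0 h]
    have e : a * c + b * c' - (a * s + b * s') / s * c = b * ((c' * s - c * s') / s) := by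
      field_simp; ring
    have hp : 0 < (c' * s - c * s') / s := div_pos (by linarith) hs
    rw [← sub_nonneg, e, mul_nonneg_iff_of_pos_right hp]
    refine ⟨fun hb => ⟨?_, hb⟩, fun hb => hb.2⟩
    have := mul_nonneg hb hs'.le
    by_contra! ha
    nlinarith
  · rw [bend_of_ge hs hs' h hu]
    have e : a * c + b * c' - (c + (a * s + b * s' - s) / s' * c')
        = (1 - a) * ((c' * s - c * s') / s') := by
      field_simp; ring
    have hp : 0 < (c' * s - c * s') / s' := div_pos (by linarith) hs'
    rw [← sub_nonneg, e, mul_nonneg_iff_of_pos_right hp]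
    refine ⟨fun ha => ⟨by linarith, ?_⟩, fun hb => by linarith [hb.1]⟩
    have := mul_nonneg ha hs.le
    by_contra! hb
    nlinarith

/-- Mirror image of `bend_le_iff` under reversal of the horizontal axis. -/
theorem le_bend_iff {s c s' c' a b : ℝ} (hs : 0 < s) (hs' : 0 < s') (hc : c' * s < c * s')
    (h0 : 0 ≤ a * s + b * s') (hu : a * s + b * s' ≤ s + s') :
    a * c + b * c' ≤ bend s c s' c' (a * s + b * s') ↔ a ≤ 1 ∧ 0 ≤ b := by
  have := bend_le_iff (c := -c) (c' := -c') hs hs' (by linarith) h0 hu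
  rw [← this]
  have e : bend s (-c) s' (-c') (a * s + b * s') = -bend s c s' c' (a * s + b * s') := by
    unfold bend; ring
  rw [e]
  constructor <;> intro h <;> linarith

theorem bend_lt_bend {s c s' c' u : ℝ} (hs : 0 < s) (hs' : 0 < s') (hc : c * s' < c' * s)
    (h0 : 0 < u) (hu : u < s + s') : bend s c s' c' u < bend s' c' s c u := by
  have key : ∀ a b : ℝ, a * s + b * s' = u → bend s c s' c' u = a * c + b * c' →
      a ≤ 1 ∧ 0 ≤ b → (b < 1 ∧ 0 < a) → bend s c s' c' u < bend s' c' s c u := by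
    rintro a b rfl e - ⟨h3, h4⟩
    by_contra! hle
    have e2 : a * s + b * s' = b * s' + a * s := by ring
    -- Trading `d` units of the first edge for `d * s / s'` units of the second keeps the height and
    -- moves strictly to the right. The bounds on `d` keep the new coefficients at least `0` and at
    -- most `1`, so the new point is still weakly left of the right side.
    have hd : 0 < min a (min ((1 - b) * s' / s) 1) := by
      have : 0 < (1 - b) * s' / s := by
        have : 0 < 1 - b := by linarith
        positivity
      exact lt_min h4 (lt_min this one_pos)
    set d := min a (min ((1 - b) * s' / s) 1)
    have d1 : d ≤ a := min_le_left _ _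
    have d2 : d * s ≤ (1 - b) * s' := by
      have := (min_le_right a _).trans (min_le_left ((1 - b) * s' / s) 1)
      exact (le_div_iff₀ hs).1 this
    have := (le_bend_iff (s := s') (c := c') (s' := s) (c' := c) (a := b + d * s / s')
      (b := a - d) hs' hs (by linarith) (by
        have : (b + d * s / s') * s' + (a - d) * s = a * s + b * s' := by field_simp; ring
        linarith) (by
        have : (b + d * s / s') * s' + (a - d) * s = a * s + b * s' := by field_simp; ring
        linarith)).2 ⟨by
          have : d * s / s' ≤ 1 - b := (div_le_iff₀ hs').2 d2
          linarith, by linarith⟩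
    have e3 : (b + d * s / s') * s' + (a - d) * s = a * s + b * s' := by field_simp; ring
    rw [e3] at this
    have e4 : (b + d * s / s') * c' + (a - d) * c = a * c + b * c'
      + d * ((c' * s - c * s') / s') := by field_simp; ring
    have hp : 0 < (c' * s - c * s') / s' := div_pos (by linarith) hs'
    have := mul_pos hd hp
    linarith
  rcases le_total u s with h | h
  · refine key (u / s) 0 (by field_simp; ring) (by rw [bend_of_le hs hs' h0.le h]; ring)
      ⟨(div_le_one hs).2 h, le_rfl⟩ ⟨one_pos, div_pos h0 hs⟩
  · refine key 1 ((u - s) / s') (by field_simp; ring)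
      (by rw [bend_of_ge hs hs' h hu.le]; ring)
      ⟨le_rfl, div_nonneg (by linarith) hs'.le⟩ ⟨(div_lt_one hs').2 (by linarith), one_pos⟩

/-! ### Edge vectors -/

theorem edgeVec_re {n : ℕ} (θ : Fin n → ℝ) (i : Fin n) : (edgeVec θ i).re = Real.cos (θ i) := by
  rw [edgeVec, Complex.exp_ofReal_mul_I_re]

theorem edgeVec_im {n : ℕ} (θ : Fin n → ℝ) (i : Fin n) : (edgeVec θ i).im = Real.sin (θ i) := by
  rw [edgeVec, Complex.exp_ofReal_mul_I_im]

/-- The vertical extent of the edges with label `i`. -/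
def drop {n : ℕ} (θ : Fin n → ℝ) (i : Fin n) : ℝ := -(edgeVec θ i).im

/-- The signed horizontal extent of the edges with label `i`. -/
def shift {n : ℕ} (θ : Fin n → ℝ) (i : Fin n) : ℝ := (edgeVec θ i).re

variable {n : ℕ} {θ : Fin n → ℝ}

theorem IsAdmissible.drop_pos (hθ : IsAdmissible θ) (i : Fin n) : 0 < drop θ i := by
  rw [drop, edgeVec_im, ← Real.sin_sub_pi]
  have := hθ.mem_Ioo i
  exact Real.sin_pos_of_pos_of_lt_pi (by linarith [this.1]) (by linarith [this.2])

/-- The difference of the two sides is the sine of `θ j - θ i`, an angle strictly between `0` and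
`π`. -/
theorem IsAdmissible.shift_mul_drop_lt (hθ : IsAdmissible θ) {i j : Fin n} (hij : i < j) :
    shift θ i * drop θ j < shift θ j * drop θ i := by
  simp only [drop, shift, edgeVec_im, edgeVec_re]
  have h := hθ.strictMono hij
  have hi := hθ.mem_Ioo i
  have hj := hθ.mem_Ioo j
  have : 0 < Real.sin (θ j - θ i) :=
    Real.sin_pos_of_pos_of_lt_pi (by linarith) (by linarith [hi.1, hj.2])
  rw [Real.sin_sub] at this
  linarith

theorem IsAdmissible.eq_of_slope_eq (hθ : IsAdmissible θ) {i j : Fin n}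
    (h : shift θ i / drop θ i = shift θ j / drop θ j) : i = j := by
  rw [div_eq_div_iff (hθ.drop_pos i).ne' (hθ.drop_pos j).ne'] at h
  rcases lt_trichotomy i j with hij | hij | hij
  · exact absurd h (hθ.shift_mul_drop_lt hij).ne
  · exact hij
  · exact absurd h (hθ.shift_mul_drop_lt hij).ne'

/-! ### Tiles as regions between two graphs -/

/-- The vertical extent of a tile. -/
def Tile.drop (θ : Fin n → ℝ) (t : Tile n) : ℝ := Elnitsky.drop θ t.lo + Elnitsky.drop θ t.hi

/-- Abscissa of the left side of a tile at a given height. -/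
def Tile.leftRe (θ : Fin n → ℝ) (t : Tile n) (h : ℝ) : ℝ :=
  t.top.re + bend (Elnitsky.drop θ t.lo) (shift θ t.lo) (Elnitsky.drop θ t.hi) (shift θ t.hi)
    (t.top.im - h)

/-- Abscissa of the right side of a tile at a given height. -/
def Tile.rightRe (θ : Fin n → ℝ) (t : Tile n) (h : ℝ) : ℝ :=
  t.top.re + bend (Elnitsky.drop θ t.hi) (shift θ t.hi) (Elnitsky.drop θ t.lo) (shift θ t.lo)
    (t.top.im - h)

theorem Tile.continuous_leftRe (t : Tile n) : Continuous (t.leftRe θ) := by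
  have := continuous_bend (Elnitsky.drop θ t.lo) (shift θ t.lo) (Elnitsky.drop θ t.hi)
    (shift θ t.hi)
  unfold Tile.leftRe; fun_prop

theorem Tile.continuous_rightRe (t : Tile n) : Continuous (t.rightRe θ) := by
  have := continuous_bend (Elnitsky.drop θ t.hi) (shift θ t.hi) (Elnitsky.drop θ t.lo)
    (shift θ t.lo)
  unfold Tile.rightRe; fun_prop

theorem Tile.leftRe_lt_rightRe (hθ : IsAdmissible θ) (t : Tile n) {h : ℝ} (h1 : h < t.top.im)
    (h2 : t.top.im - t.drop θ < h) : t.leftRe θ h < t.rightRe θ h := by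
  have := bend_lt_bend (hθ.drop_pos t.lo) (hθ.drop_pos t.hi) (hθ.shift_mul_drop_lt t.lo_lt_hi)
    (u := t.top.im - h) (by linarith) (by unfold Tile.drop at h2; linarith)
  unfold Tile.leftRe Tile.rightRe
  linarith

/-- In rhombus coordinates, being right of the left side means `a ≤ 1` and `0 ≤ b`, and being left
of the right side means `b ≤ 1` and `0 ≤ a`; together these cut out the unit square. -/
theorem Tile.mem_carrier_iff (hθ : IsAdmissible θ) (t : Tile n) (p : ℂ) :
    p ∈ t.carrier θ ↔ t.top.im - t.drop θ ≤ p.im ∧ p.im ≤ t.top.im ∧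
      t.leftRe θ p.im ≤ p.re ∧ p.re ≤ t.rightRe θ p.im := by
  have hl := hθ.drop_pos t.lo
  have hh := hθ.drop_pos t.hi
  have hc := hθ.shift_mul_drop_lt t.lo_lt_hi
  have key : ∀ a b : ℝ, p = t.top + a • edgeVec θ t.lo + b • edgeVec θ t.hi →
      ((a ∈ Set.Icc (0 : ℝ) 1 ∧ b ∈ Set.Icc (0 : ℝ) 1) ↔ t.top.im - t.drop θ ≤ p.im ∧
        p.im ≤ t.top.im ∧ t.leftRe θ p.im ≤ p.re ∧ p.re ≤ t.rightRe θ p.im) := by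
    intro a b hp
    have h1 : t.top.im - p.im = a * Elnitsky.drop θ t.lo + b * Elnitsky.drop θ t.hi := by
      rw [hp]; simp [Elnitsky.drop]; ring
    have h2 : p.re = t.top.re + (a * shift θ t.lo + b * shift θ t.hi) := by
      rw [hp]; simp [shift]; ring
    unfold Tile.leftRe Tile.rightRe Tile.drop
    rw [h1, h2, add_le_add_iff_left, add_le_add_iff_left]
    constructor
    · rintro ⟨⟨a0, a1⟩, b0, b1⟩
      have i1 := mul_nonneg a0 hl.le
      have i2 := mul_nonneg b0 hh.le
      have i3 : a * Elnitsky.drop θ t.lo ≤ Elnitsky.drop θ t.lo := by nlinarith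
      have i4 : b * Elnitsky.drop θ t.hi ≤ Elnitsky.drop θ t.hi := by nlinarith
      refine ⟨by linarith, by linarith, ?_, ?_⟩
      · exact (bend_le_iff hl hh hc (by linarith) (by linarith)).2 ⟨a1, b0⟩
      · have := (le_bend_iff (a := b) (b := a) hh hl hc (by linarith) (by linarith)).2 ⟨b1, a0⟩
        rw [add_comm (b * _), add_comm (b * _)] at this
        exact this
    · rintro ⟨g1, g2, g3, g4⟩
      have j1 := (bend_le_iff hl hh hc (by linarith) (by linarith)).1 g3
      rw [add_comm (a * _), add_comm (a * _)] at g4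
      have j2 := (le_bend_iff hh hl hc (by linarith) (by linarith)).1 g4
      exact ⟨⟨j2.2, j1.1⟩, j1.2, j2.1⟩
  constructor
  · rintro ⟨a, ha, b, hb, hp⟩
    exact (key a b hp).1 ⟨ha, hb⟩
  · intro h
    set sl := Elnitsky.drop θ t.lo with hsl
    set sh := Elnitsky.drop θ t.hi with hsh
    set D := shift θ t.hi * sl - shift θ t.lo * sh with hD
    have hD0 : D ≠ 0 := by rw [hD]; linarith
    set u := t.top.im - p.im with hu
    set v := p.re - t.top.re with hv
    -- Rhombus coordinates of `p` by Cramer's rule, with determinant `D`.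
    have hp : p = t.top + ((u * shift θ t.hi - v * sh) / D) • edgeVec θ t.lo +
        ((v * sl - u * shift θ t.lo) / D) • edgeVec θ t.hi := by
      apply Complex.ext
      · simp only [Complex.add_re, Complex.real_smul, Complex.re_ofReal_mul]
        change p.re = t.top.re + (u * shift θ t.hi - v * sh) / D * shift θ t.lo +
          (v * sl - u * shift θ t.lo) / D * shift θ t.hi
        have : p.re = t.top.re + v := by rw [hv]; ring
        rw [this]; field_simp; rw [hD]; ring
      · simp only [Complex.add_im, Complex.real_smul, Complex.im_ofReal_mul]
        have e1 : (edgeVec θ t.lo).im = -sl := by rw [hsl, Elnitsky.drop, neg_neg]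
        have e2 : (edgeVec θ t.hi).im = -sh := by rw [hsh, Elnitsky.drop, neg_neg]
        rw [e1, e2]
        have : p.im = t.top.im - u := by rw [hu]; ring
        rw [this]; field_simp; rw [hD]; ring
    have := (key _ _ hp).2 h
    exact ⟨_, this.1, _, this.2, hp⟩

theorem Tile.isClosed_carrier (hθ : IsAdmissible θ) (t : Tile n) : IsClosed (t.carrier θ) := by
  have h1 := t.continuous_leftRe (θ := θ)
  have h2 := t.continuous_rightRe (θ := θ)
  have e : t.carrier θ = {p | t.top.im - t.drop θ ≤ p.im} ∩ {p | p.im ≤ t.top.im} ∩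
      {p | t.leftRe θ p.im ≤ p.re} ∩ {p | p.re ≤ t.rightRe θ p.im} := by
    ext p; rw [t.mem_carrier_iff hθ]; simp [and_assoc]
  rw [e]
  have c1 := Complex.continuous_im
  have c2 := Complex.continuous_re
  exact ((((isClosed_le (by fun_prop) (by fun_prop)).inter
    (isClosed_le (by fun_prop) (by fun_prop))).inter
    (isClosed_le (by fun_prop) (by fun_prop))).inter (isClosed_le (by fun_prop) (by fun_prop)))

theorem Tile.convex_carrier (t : Tile n) : Convex ℝ (t.carrier θ) := by
  rintro p ⟨a, ha, b, hb, rfl⟩ q ⟨a', ha', b', hb', rfl⟩ x y hx hy hxy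
  refine ⟨x • a + y • a', convex_Icc 0 1 ha ha' hx hy hxy, x • b + y • b',
    convex_Icc 0 1 hb hb' hx hy hxy, ?_⟩
  have : t.top = (x + y) • t.top := by rw [hxy, one_smul]
  nth_rewrite 3 [this]
  simp only [smul_add, add_smul, smul_smul, smul_eq_mul]
  abel

theorem Tile.mem_interior_iff (hθ : IsAdmissible θ) (t : Tile n) (p : ℂ) :
    p ∈ interior (t.carrier θ) ↔ t.top.im - t.drop θ < p.im ∧ p.im < t.top.im ∧
      t.leftRe θ p.im < p.re ∧ p.re < t.rightRe θ p.im := by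
  constructor
  · intro hp
    have hev := fun v : ℂ => (show ∀ᶠ e : ℝ in nhds 0, p + e • v ∈ t.carrier θ from by
      have c : Continuous fun e : ℝ => p + e • v := by fun_prop
      refine (c.tendsto 0).eventually ?_
      simpa using mem_interior_iff_mem_nhds.1 hp)
    have pert : ∀ v : ℂ, ∃ e > (0 : ℝ), p + e • v ∈ t.carrier θ := fun v => by
      have h1 : ∀ᶠ e : ℝ in nhdsWithin 0 (Set.Ioi 0), p + e • v ∈ t.carrier θ :=
        (hev v).filter_mono nhdsWithin_le_nhds
      obtain ⟨e, he, he'⟩ := (h1.and self_mem_nhdsWithin).exists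
      exact ⟨e, he', he⟩
    obtain ⟨e1, h1, k1⟩ := pert 1
    obtain ⟨e2, h2, k2⟩ := pert (-1)
    obtain ⟨e3, h3, k3⟩ := pert Complex.I
    obtain ⟨e4, h4, k4⟩ := pert (-Complex.I)
    rw [t.mem_carrier_iff hθ] at k1 k2 k3 k4
    simp at k1 k2 k3 k4
    exact ⟨by linarith [k4.1], by linarith [k3.2.1], by linarith [k2.2.2.1],
      by linarith [k1.2.2.2]⟩
  · intro hp
    have h1 := t.continuous_leftRe (θ := θ)
    have h2 := t.continuous_rightRe (θ := θ)
    have c1 := Complex.continuous_im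
    have c2 := Complex.continuous_re
    refine mem_interior.2 ⟨{p | t.top.im - t.drop θ < p.im} ∩ {p | p.im < t.top.im} ∩
      {p | t.leftRe θ p.im < p.re} ∩ {p | p.re < t.rightRe θ p.im}, ?_, ?_, ?_⟩
    · rintro q ⟨⟨⟨q1, q2⟩, q3⟩, q4⟩
      exact (t.mem_carrier_iff hθ q).2 ⟨le_of_lt q1, le_of_lt q2, le_of_lt q3, le_of_lt q4⟩
    · exact ((((isOpen_lt (by fun_prop) (by fun_prop)).inter
        (isOpen_lt (by fun_prop) (by fun_prop))).inter
        (isOpen_lt (by fun_prop) (by fun_prop))).inter (isOpen_lt (by fun_prop) (by fun_prop)))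
    · exact ⟨⟨⟨hp.1, hp.2.1⟩, hp.2.2.1⟩, hp.2.2.2⟩

theorem Tile.drop_pos (hθ : IsAdmissible θ) (t : Tile n) : 0 < t.drop θ :=
  add_pos (hθ.drop_pos _) (hθ.drop_pos _)

/-- At every height strictly between its bottom and its top a tile has interior points. -/
theorem Tile.exists_mem_interior (hθ : IsAdmissible θ) (t : Tile n) {h : ℝ}
    (h1 : t.top.im - t.drop θ < h) (h2 : h < t.top.im) :
    ∃ p ∈ interior (t.carrier θ), p.im = h := by
  have := t.leftRe_lt_rightRe hθ h2 h1
  refine ⟨⟨(t.leftRe θ h + t.rightRe θ h) / 2, h⟩, ?_, rfl⟩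
  rw [t.mem_interior_iff hθ]
  exact ⟨h1, h2, by dsimp only; linarith, by dsimp only; linarith⟩

theorem Tile.closure_interior (hθ : IsAdmissible θ) (t : Tile n) :
    closure (interior (t.carrier θ)) = t.carrier θ := by
  have hd := t.drop_pos hθ
  obtain ⟨p, hp, -⟩ := t.exists_mem_interior hθ (h := t.top.im - t.drop θ / 2)
    (by linarith) (by linarith)
  rw [t.convex_carrier.closure_interior_eq_closure_of_nonempty_interior ⟨p, hp⟩,
    (t.isClosed_carrier hθ).closure_eq]

/-! ### Descending paths as graphs -/

theorem pathVertex_zero (σ : Equiv.Perm (Fin n)) : pathVertex θ σ 0 = 0 := by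
  simp [pathVertex]

theorem pathVertex_succ (σ : Equiv.Perm (Fin n)) {k : ℕ} (hk : k < n) :
    pathVertex θ σ (k + 1) = pathVertex θ σ k + edgeVec θ (σ ⟨k, hk⟩) := by
  unfold pathVertex
  have : univ.filter (fun i : Fin n => (i : ℕ) < k + 1)
      = insert ⟨k, hk⟩ (univ.filter (fun i : Fin n => (i : ℕ) < k)) := by
    ext i; simp [Fin.ext_iff]; omega
  rw [this, sum_insert (by simp), add_comm]

/-- The height of the `k`-th vertex of a path. -/
def level (θ : Fin n → ℝ) (σ : Equiv.Perm (Fin n)) (k : ℕ) : ℝ := (pathVertex θ σ k).im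

theorem level_zero (σ : Equiv.Perm (Fin n)) : level θ σ 0 = 0 := by
  simp [level, pathVertex_zero]

theorem level_succ (σ : Equiv.Perm (Fin n)) {k : ℕ} (hk : k < n) :
    level θ σ (k + 1) = level θ σ k - drop θ (σ ⟨k, hk⟩) := by
  simp [level, pathVertex_succ σ hk, drop]

theorem level_antitone (hθ : IsAdmissible θ) (σ : Equiv.Perm (Fin n)) :
    Antitone (level θ σ) := by
  refine antitone_nat_of_succ_le fun k => ?_
  by_cases hk : k < n
  · rw [level_succ σ hk]; linarith [hθ.drop_pos (σ ⟨k, hk⟩)]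
  · refine le_of_eq ?_
    unfold level pathVertex
    congr 2
    ext i; simp; omega

theorem level_lt (hθ : IsAdmissible θ) (σ : Equiv.Perm (Fin n)) {i j : ℕ} (hij : i < j)
    (hj : j ≤ n) : level θ σ j < level θ σ i := by
  have h1 := level_antitone hθ σ (show i + 1 ≤ j from hij)
  have h2 := level_succ (θ := θ) σ (show i < n by omega)
  linarith [hθ.drop_pos (σ ⟨i, by omega⟩)]

theorem pathVertex_length (σ : Equiv.Perm (Fin n)) :
    pathVertex θ σ n = pathVertex θ 1 n := by
  simp only [pathVertex, Fin.is_lt, filter_true, Equiv.Perm.coe_one, id]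
  exact Equiv.sum_comp σ (edgeVec θ)

theorem level_length (σ : Equiv.Perm (Fin n)) : level θ σ n = level θ 1 n := by
  rw [level, pathVertex_length, level]

/-- Abscissa of the point at height `h` of a path. -/
def pathRe (θ : Fin n → ℝ) (σ : Equiv.Perm (Fin n)) (h : ℝ) : ℝ :=
  ∑ i : Fin n, ramp (drop θ (σ i)) (level θ σ i - h) * shift θ (σ i)

theorem continuous_pathRe (σ : Equiv.Perm (Fin n)) : Continuous (pathRe θ σ) := by
  have := fun s => continuous_ramp s
  unfold pathRe; fun_prop

theorem pathVertex_re (σ : Equiv.Perm (Fin n)) (k : ℕ) :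
    (pathVertex θ σ k).re = ∑ i : Fin n, if (i : ℕ) < k then shift θ (σ i) else 0 := by
  rw [pathVertex, Complex.re_sum, sum_filter]; rfl

/-- At such a height the ramps of earlier edges are saturated at `1`, those of later edges are still
`0`, and only the ramp of edge `k` is partial. -/
theorem pathRe_of_mem (hθ : IsAdmissible θ) (σ : Equiv.Perm (Fin n)) {k : ℕ} (hk : k < n) {h : ℝ}
    (h1 : level θ σ (k + 1) ≤ h) (h2 : h ≤ level θ σ k) :
    pathRe θ σ h = (pathVertex θ σ k).re +
      (level θ σ k - h) / drop θ (σ ⟨k, hk⟩) * shift θ (σ ⟨k, hk⟩) := by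
  have e : ∀ i : Fin n, ramp (drop θ (σ i)) (level θ σ i - h) * shift θ (σ i) =
      (if (i : ℕ) < k then shift θ (σ i) else 0) +
      (if i = ⟨k, hk⟩ then (level θ σ k - h) / drop θ (σ ⟨k, hk⟩) * shift θ (σ ⟨k, hk⟩)
        else 0) := by
    intro i
    have hd := hθ.drop_pos (σ i)
    rcases lt_trichotomy (i : ℕ) k with hik | hik | hik
    · have := level_antitone hθ σ (show (i : ℕ) + 1 ≤ k from hik)
      rw [level_succ σ i.2] at this
      rw [ramp_of_ge hd (by simp only [Fin.eta] at this; linarith), if_pos hik,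
        if_neg (by rintro rfl; simp at hik)]
      ring
    · have hi : i = ⟨k, hk⟩ := Fin.ext hik
      subst hi
      rw [level_succ σ hk] at h1
      rw [ramp_of_mem hd (by simpa using h2) (by dsimp only; linarith)]
      simp
    · have := level_antitone hθ σ (show k + 1 ≤ (i : ℕ) from hik)
      rw [ramp_of_nonpos hd (by linarith), if_neg (by omega),
        if_neg (by rintro rfl; simp at hik)]
      ring
  rw [pathRe, sum_congr rfl fun i _ => e i, sum_add_distrib, pathVertex_re]
  simp

/-- Every height in the range of a path is in the range of one of its edges. -/
theorem exists_level_lt_le (σ : Equiv.Perm (Fin n)) {h : ℝ}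
    (h1 : level θ σ n ≤ h) (h2 : h < 0) :
    ∃ k, ∃ _ : k < n, level θ σ (k + 1) ≤ h ∧ h < level θ σ k := by
  classical
  have hex : ∃ k, level θ σ k ≤ h := ⟨n, h1⟩
  have hle : Nat.find hex ≤ n := Nat.find_min' hex h1
  have hspec := Nat.find_spec hex
  obtain ⟨j, hj⟩ : ∃ j, Nat.find hex = j + 1 := by
    refine Nat.exists_eq_succ_of_ne_zero fun h0 => ?_
    rw [h0, level_zero] at hspec
    linarith
  refine ⟨j, by omega, hj ▸ hspec, ?_⟩
  have := Nat.find_min hex (m := j) (by omega)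
  exact not_le.1 this

theorem mem_pathEdge_iff (hθ : IsAdmissible θ) (σ : Equiv.Perm (Fin n)) {k : ℕ} (hk : k < n)
    (p : ℂ) : p ∈ pathEdge θ σ k ↔
      level θ σ (k + 1) ≤ p.im ∧ p.im ≤ level θ σ k ∧ p.re = pathRe θ σ p.im := by
  have hd := hθ.drop_pos (σ ⟨k, hk⟩)
  have hls := level_succ (θ := θ) σ hk
  rw [pathEdge, segment_eq_image', pathVertex_succ σ hk]
  simp only [add_sub_cancel_left, Set.mem_image, Set.mem_Icc]
  constructor
  · rintro ⟨t, ⟨t0, t1⟩, rfl⟩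
    have him : (pathVertex θ σ k + t • edgeVec θ (σ ⟨k, hk⟩)).im =
        level θ σ k - t * drop θ (σ ⟨k, hk⟩) := by
      simp [level, drop]
    have b1 : level θ σ (k + 1) ≤ (pathVertex θ σ k + t • edgeVec θ (σ ⟨k, hk⟩)).im := by
      rw [him]; nlinarith
    have b2 : (pathVertex θ σ k + t • edgeVec θ (σ ⟨k, hk⟩)).im ≤ level θ σ k := by
      rw [him]; nlinarith
    refine ⟨b1, b2, ?_⟩
    rw [pathRe_of_mem hθ σ hk b1 b2, him]
    simp [shift]
    field_simp
    simp
  · rintro ⟨h1, h2, h3⟩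
    refine ⟨(level θ σ k - p.im) / drop θ (σ ⟨k, hk⟩),
      ⟨div_nonneg (by linarith) hd.le, (div_le_one hd).2 (by linarith)⟩, ?_⟩
    rw [pathRe_of_mem hθ σ hk h1 h2] at h3
    apply Complex.ext
    · rw [h3]; simp [shift]
    · have : (edgeVec θ (σ ⟨k, hk⟩)).im = -drop θ (σ ⟨k, hk⟩) := by simp [drop]
      simp only [Complex.add_im, Complex.real_smul, Complex.im_ofReal_mul, this]
      change level θ σ k + _ = _
      field_simp
      ring

/-- `0 < n` matters: for `n = 0` the union of edges is empty, while the right-hand side still holds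
at the origin. -/
theorem mem_path_iff (hθ : IsAdmissible θ) (hn : 0 < n) (σ : Equiv.Perm (Fin n)) (p : ℂ) :
    p ∈ path θ σ ↔ level θ 1 n ≤ p.im ∧ p.im ≤ 0 ∧ p.re = pathRe θ σ p.im := by
  rw [path, Set.mem_iUnion, ← level_length σ]
  constructor
  · rintro ⟨k, hk⟩
    rw [mem_pathEdge_iff hθ σ k.2] at hk
    refine ⟨(level_antitone hθ σ (show (k : ℕ) + 1 ≤ n from k.2)).trans hk.1, ?_, hk.2.2⟩
    rw [← level_zero (θ := θ) σ]
    exact hk.2.1.trans (level_antitone hθ σ (Nat.zero_le _))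
  · rintro ⟨h1, h2, h3⟩
    rcases h2.lt_or_eq with h2 | h2
    · obtain ⟨k, hk, hk1, hk2⟩ := exists_level_lt_le σ h1 h2
      exact ⟨⟨k, hk⟩, (mem_pathEdge_iff hθ σ hk p).2 ⟨hk1, hk2.le, h3⟩⟩
    · refine ⟨⟨0, hn⟩, (mem_pathEdge_iff hθ σ hn p).2 ⟨?_, ?_, h3⟩⟩
      · rw [h2, ← level_zero (θ := θ) σ]; exact level_antitone hθ σ (Nat.zero_le _)
      · rw [h2, level_zero]

theorem mem_polygon_iff (hθ : IsAdmissible θ) (hn : 0 < n) (w : Equiv.Perm (Fin n)) (p : ℂ) :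
    p ∈ polygon θ w ↔ level θ 1 n ≤ p.im ∧ p.im ≤ 0 ∧
      pathRe θ 1 p.im ≤ p.re ∧ p.re ≤ pathRe θ w p.im := by
  constructor
  · rintro ⟨l, hl, r, hr, h1, h2, h3, h4⟩
    obtain ⟨l1, l2, l3⟩ := (mem_path_iff hθ hn 1 l).1 hl
    obtain ⟨r1, r2, r3⟩ := (mem_path_iff hθ hn w r).1 hr
    rw [h1] at l1 l2 l3
    rw [h2] at r3
    exact ⟨l1, l2, by linarith, by linarith⟩
  · rintro ⟨h1, h2, h3, h4⟩
    exact ⟨⟨pathRe θ 1 p.im, p.im⟩, (mem_path_iff hθ hn 1 _).2 ⟨h1, h2, rfl⟩,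
      ⟨pathRe θ w p.im, p.im⟩, (mem_path_iff hθ hn w _).2 ⟨h1, h2, rfl⟩, rfl, rfl, h3, h4⟩

theorem isClosed_polygon (hθ : IsAdmissible θ) (hn : 0 < n) (w : Equiv.Perm (Fin n)) :
    IsClosed (polygon θ w) := by
  have h1 := continuous_pathRe (θ := θ) 1
  have h2 := continuous_pathRe (θ := θ) w
  have e : polygon θ w = {p | level θ 1 n ≤ p.im} ∩ {p | p.im ≤ 0} ∩
      {p | pathRe θ 1 p.im ≤ p.re} ∩ {p | p.re ≤ pathRe θ w p.im} := by
    ext p; rw [mem_polygon_iff hθ hn]; simp [and_assoc]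
  rw [e]
  have c1 := Complex.continuous_im
  have c2 := Complex.continuous_re
  exact ((((isClosed_le (by fun_prop) (by fun_prop)).inter
    (isClosed_le (by fun_prop) (by fun_prop))).inter
    (isClosed_le (by fun_prop) (by fun_prop))).inter (isClosed_le (by fun_prop) (by fun_prop)))

/-! ### Exchanging two adjacent labels -/

/-- The permutation obtained from `w` by exchanging the entries at positions `a` and `a + 1`. -/
def exchange (w : Equiv.Perm (Fin n)) (a : ℕ) (ha : a + 1 < n) : Equiv.Perm (Fin n) :=
  w * Equiv.swap ⟨a, Nat.lt_of_succ_lt ha⟩ ⟨a + 1, ha⟩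

section

variable (w : Equiv.Perm (Fin n)) {a : ℕ} (ha : a + 1 < n)

theorem exchange_left :
    exchange w a ha ⟨a, Nat.lt_of_succ_lt ha⟩ = w ⟨a + 1, ha⟩ := by
  simp [exchange]

theorem exchange_right :
    exchange w a ha ⟨a + 1, ha⟩ = w ⟨a, Nat.lt_of_succ_lt ha⟩ := by
  simp [exchange]

theorem exchange_of_ne {i : Fin n} (h1 : (i : ℕ) ≠ a) (h2 : (i : ℕ) ≠ a + 1) :
    exchange w a ha i = w i := by
  simp only [exchange, Equiv.Perm.mul_apply]
  rw [Equiv.swap_apply_of_ne_of_ne] <;> simpa [Fin.ext_iff]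

theorem pathVertex_exchange {j : ℕ} (hj : j ≠ a + 1) :
    pathVertex θ (exchange w a ha) j = pathVertex θ w j := by
  unfold pathVertex exchange
  refine sum_equiv (Equiv.swap ⟨a, Nat.lt_of_succ_lt ha⟩ ⟨a + 1, ha⟩) (fun i => ?_)
    (fun i _ => rfl)
  simp only [mem_filter, mem_univ, true_and]
  rcases eq_or_ne i ⟨a, Nat.lt_of_succ_lt ha⟩ with rfl | h1
  · rw [Equiv.swap_apply_left]; dsimp only; omega
  rcases eq_or_ne i ⟨a + 1, ha⟩ with rfl | h2
  · rw [Equiv.swap_apply_right]; dsimp only; omega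
  rw [Equiv.swap_apply_of_ne_of_ne h1 h2]

theorem level_exchange {j : ℕ} (hj : j ≠ a + 1) :
    level θ (exchange w a ha) j = level θ w j := by
  rw [level, pathVertex_exchange w ha hj, level]

/-- The rhombus on the inner side of the edges at positions `a` and `a + 1`, for a descent of `w`
at position `a`. -/
def descentTile (θ : Fin n → ℝ) (hd : w ⟨a + 1, ha⟩ < w ⟨a, Nat.lt_of_succ_lt ha⟩) : Tile n :=
  ⟨pathVertex θ w a, w ⟨a + 1, ha⟩, w ⟨a, Nat.lt_of_succ_lt ha⟩, hd⟩

variable {w} {ha} (hd : w ⟨a + 1, ha⟩ < w ⟨a, Nat.lt_of_succ_lt ha⟩)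

theorem descentTile_bottom :
    (descentTile w ha θ hd).top.im - (descentTile w ha θ hd).drop θ = level θ w (a + 2) := by
  rw [level_succ w ha, level_succ w (Nat.lt_of_succ_lt ha)]
  simp only [descentTile, Tile.drop, level]
  ring

/-- Only the two exchanged ramps fail to cancel, and they are the two bends of the tile. As bends
are constant beyond the tile, the identity needs no restriction on `h`. -/
theorem pathRe_sub_pathRe_exchange (hd : w ⟨a + 1, ha⟩ < w ⟨a, Nat.lt_of_succ_lt ha⟩) (h : ℝ) :
    pathRe θ w h - pathRe θ (exchange w a ha) h =
      (descentTile w ha θ hd).rightRe θ h - (descentTile w ha θ hd).leftRe θ h := by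
  unfold pathRe
  rw [← sum_sub_distrib, sum_eq_add ⟨a, Nat.lt_of_succ_lt ha⟩ ⟨a + 1, ha⟩ (by simp [Fin.ext_iff])]
  · have e1 := level_succ (θ := θ) w (Nat.lt_of_succ_lt ha)
    have e2 := level_succ (θ := θ) (exchange w a ha) (Nat.lt_of_succ_lt ha)
    rw [exchange_left, level_exchange w ha (j := a) (by omega)] at e2
    rw [exchange_left, exchange_right]
    dsimp only
    rw [e1, e2, level_exchange w ha (j := a) (by omega)]
    simp only [Tile.rightRe, Tile.leftRe, bend, descentTile, level]
    rw [sub_right_comm _ h, sub_right_comm _ h]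
    ring
  · rintro i - ⟨h1, h2⟩
    rw [Ne, Fin.ext_iff] at h1 h2
    rw [exchange_of_ne w ha h1 h2, level_exchange w ha h2, sub_self]
  · simp
  · simp

theorem pathRe_eq_rightRe (hθ : IsAdmissible θ) {h : ℝ} (h1 : level θ w (a + 2) ≤ h)
    (h2 : h ≤ level θ w a) : pathRe θ w h = (descentTile w ha θ hd).rightRe θ h := by
  have p1 := hθ.drop_pos (w ⟨a + 1, ha⟩)
  have p2 := hθ.drop_pos (w ⟨a, Nat.lt_of_succ_lt ha⟩)
  have e1 := level_succ (θ := θ) w (Nat.lt_of_succ_lt ha)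
  have e2 := level_succ (θ := θ) w ha
  simp only [Tile.rightRe, descentTile]
  change _ = _ + bend _ _ _ _ (level θ w a - h)
  rcases le_total (level θ w (a + 1)) h with h3 | h3
  · rw [bend_of_le p2 p1 (by linarith) (by linarith),
      pathRe_of_mem hθ w (Nat.lt_of_succ_lt ha) h3 h2]
  · rw [bend_of_ge p2 p1 (by linarith) (by linarith), pathRe_of_mem hθ w ha h1 h3,
      pathVertex_succ w (Nat.lt_of_succ_lt ha), e1, Complex.add_re, sub_right_comm, add_assoc]
    rfl

theorem pathRe_exchange_eq (hθ : IsAdmissible θ)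
    (hd : w ⟨a + 1, ha⟩ < w ⟨a, Nat.lt_of_succ_lt ha⟩) {h : ℝ}
    (hh : h ≤ level θ w (a + 2) ∨ level θ w a ≤ h) :
    pathRe θ (exchange w a ha) h = pathRe θ w h := by
  have p1 := hθ.drop_pos (w ⟨a + 1, ha⟩)
  have p2 := hθ.drop_pos (w ⟨a, Nat.lt_of_succ_lt ha⟩)
  have e1 := level_succ (θ := θ) w (Nat.lt_of_succ_lt ha)
  have e2 := level_succ (θ := θ) w ha
  have := pathRe_sub_pathRe_exchange (θ := θ) hd h
  suffices (descentTile w ha θ hd).rightRe θ h = (descentTile w ha θ hd).leftRe θ h by linarith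
  simp only [Tile.rightRe, Tile.leftRe, descentTile]
  change _ + bend _ _ _ _ (level θ w a - h) = _ + bend _ _ _ _ (level θ w a - h)
  rcases hh with hh | hh
  · rw [bend_of_ge_add p2 p1 (by linarith), bend_of_ge_add p1 p2 (by linarith)]; ring
  · rw [bend_of_nonpos p2 p1 (by linarith), bend_of_nonpos p1 p2 (by linarith)]

theorem pathRe_exchange_lt (hθ : IsAdmissible θ)
    (hd : w ⟨a + 1, ha⟩ < w ⟨a, Nat.lt_of_succ_lt ha⟩) {h : ℝ}
    (h1 : level θ w (a + 2) < h) (h2 : h < level θ w a) :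
    pathRe θ (exchange w a ha) h < pathRe θ w h := by
  have := pathRe_sub_pathRe_exchange (θ := θ) hd h
  have := (descentTile w ha θ hd).leftRe_lt_rightRe hθ h2 (by rwa [descentTile_bottom])
  linarith

theorem pathRe_exchange_le (hθ : IsAdmissible θ)
    (hd : w ⟨a + 1, ha⟩ < w ⟨a, Nat.lt_of_succ_lt ha⟩) (h : ℝ) :
    pathRe θ (exchange w a ha) h ≤ pathRe θ w h := by
  by_cases hh : h ≤ level θ w (a + 2) ∨ level θ w a ≤ h
  · exact (pathRe_exchange_eq hθ hd hh).le
  · push Not at hh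
    exact (pathRe_exchange_lt hθ hd hh.1 hh.2).le

theorem mem_descentTile_iff (hθ : IsAdmissible θ) (p : ℂ) :
    p ∈ (descentTile w ha θ hd).carrier θ ↔ level θ w (a + 2) ≤ p.im ∧ p.im ≤ level θ w a ∧
      pathRe θ (exchange w a ha) p.im ≤ p.re ∧ p.re ≤ pathRe θ w p.im := by
  rw [Tile.mem_carrier_iff hθ, descentTile_bottom]
  refine and_congr_right fun h1 => and_congr_right fun h2 => ?_
  change p.im ≤ level θ w a at h2
  have := pathRe_sub_pathRe_exchange (θ := θ) hd p.im
  have := pathRe_eq_rightRe hd hθ h1 h2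
  constructor <;> rintro ⟨_, _⟩ <;> constructor <;> linarith

theorem mem_interior_descentTile_iff (hθ : IsAdmissible θ) (p : ℂ) :
    p ∈ interior ((descentTile w ha θ hd).carrier θ) ↔
      level θ w (a + 2) < p.im ∧ p.im < level θ w a ∧
      pathRe θ (exchange w a ha) p.im < p.re ∧ p.re < pathRe θ w p.im := by
  rw [Tile.mem_interior_iff hθ, descentTile_bottom]
  refine and_congr_right fun h1 => and_congr_right fun h2 => ?_
  change p.im < level θ w a at h2
  have := pathRe_sub_pathRe_exchange (θ := θ) hd p.im
  have := pathRe_eq_rightRe hd hθ h1.le h2.le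
  constructor <;> rintro ⟨_, _⟩ <;> constructor <;> linarith

end

/-- Induction on permutations by removing descents. -/
theorem descent_induction {P : Equiv.Perm (Fin n) → Prop} (one : P 1)
    (step : ∀ (w : Equiv.Perm (Fin n)) (a : ℕ) (ha : a + 1 < n),
      w ⟨a + 1, ha⟩ < w ⟨a, Nat.lt_of_succ_lt ha⟩ → P (exchange w a ha) → P w)
    (w : Equiv.Perm (Fin n)) : P w := by
  -- The weights `n - i` decrease by one per position, so exchanging a descent lowers the sum by
  -- exactly `w a - w (a + 1)`.
  induction hm : ∑ i : Fin n, (n - (i : ℕ)) * (w i : ℕ) using Nat.strong_induction_on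
    generalizing w with
  | _ m ih =>
    subst hm
    by_cases hdes : ∃ a, ∃ ha : a + 1 < n, w ⟨a + 1, ha⟩ < w ⟨a, Nat.lt_of_succ_lt ha⟩
    · obtain ⟨a, ha, hd⟩ := hdes
      refine step w a ha hd (ih _ ?_ _ rfl)
      rw [← Nat.cast_lt (α := ℤ), ← sub_pos, Nat.cast_sum, Nat.cast_sum, ← sum_sub_distrib,
        sum_eq_add ⟨a, Nat.lt_of_succ_lt ha⟩ ⟨a + 1, ha⟩ (by simp [Fin.ext_iff])]
      · rw [exchange_left, exchange_right]
        obtain ⟨m, rfl⟩ : ∃ m, n = a + 1 + m := ⟨n - (a + 1), by omega⟩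
        have e1 : a + 1 + m - a = m + 1 := by omega
        have e2 : a + 1 + m - (a + 1) = m := by omega
        have hd' : ((w ⟨a + 1, ha⟩ : ℕ) : ℤ) < (w ⟨a, Nat.lt_of_succ_lt ha⟩ : ℕ) := by
          exact_mod_cast hd
        dsimp only
        rw [e1, e2]
        push_cast
        linarith
      · rintro i - ⟨h1, h2⟩
        rw [Ne, Fin.ext_iff] at h1 h2
        rw [exchange_of_ne w ha h1 h2, sub_self]
      · simp
      · simp
    · push Not at hdes
      suffices w = 1 by rwa [this]
      have hmono : StrictMono w := by
        obtain _ | n := n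
        · exact fun i => i.elim0
        · refine Fin.strictMono_iff_lt_succ.2 fun i => ?_
          refine lt_of_le_of_ne (hdes i (by omega)) fun h => ?_
          have := w.injective h
          simp [Fin.ext_iff] at this
      have := (StrictMono.range_inj hmono (strictMono_id (α := Fin n))).1 (by simp)
      ext i
      rw [this]; rfl

theorem pathRe_one_le (hθ : IsAdmissible θ) (w : Equiv.Perm (Fin n)) (h : ℝ) :
    pathRe θ 1 h ≤ pathRe θ w h := by
  induction w using descent_induction with
  | one => exact le_rfl
  | step w a ha hd ih => exact ih.trans (pathRe_exchange_le hθ hd h)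

/-! ### Tilings up to the degenerate part of the polygon -/

/-- The points strictly between the two boundary paths. -/
def openPart (θ : Fin n → ℝ) (w : Equiv.Perm (Fin n)) : Set ℂ :=
  {p | pathRe θ 1 p.im < p.re ∧ p.re < pathRe θ w p.im}

/-- A family of nonoverlapping tiles inside `X(w)` that covers everything strictly between the two
boundary paths. In contrast to `IsRhombicTiling` this is meaningful where these paths meet. -/
structure IsWeakTiling (θ : Fin n → ℝ) (w : Equiv.Perm (Fin n)) (T : Finset (Tile n)) : Prop where
  nonoverlapping : ∀ s ∈ T, ∀ t ∈ T, s ≠ t →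
    Disjoint (interior (s.carrier θ)) (interior (t.carrier θ))
  subset_polygon : ∀ t ∈ T, t.carrier θ ⊆ polygon θ w
  openPart_subset : openPart θ w ⊆ ⋃ t ∈ T, t.carrier θ

/-- Beyond the vertical range of the polygon `pathRe` is constant and independent of the
permutation: `0` above, the sum of all shifts below. -/
theorem openPart_subset_polygon (hθ : IsAdmissible θ) (hn : 0 < n) (w : Equiv.Perm (Fin n)) :
    openPart θ w ⊆ polygon θ w := by
  rintro p ⟨h1, h2⟩
  rw [mem_polygon_iff hθ hn]
  suffices level θ 1 n ≤ p.im ∧ p.im ≤ 0 from ⟨this.1, this.2, h1.le, h2.le⟩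
  by_contra hcon
  suffices pathRe θ 1 p.im = pathRe θ w p.im by linarith
  rw [not_and_or, not_le, not_le] at hcon
  rcases hcon with h | h
  · have key : ∀ σ : Equiv.Perm (Fin n), pathRe θ σ p.im = ∑ i, shift θ (σ i) := fun σ => by
      refine sum_congr rfl fun i _ => ?_
      have e := level_succ (θ := θ) σ i.2
      have := level_antitone hθ σ (show (i : ℕ) + 1 ≤ n from i.2)
      rw [level_length] at this
      simp only [Fin.eta] at e
      rw [ramp_of_ge (hθ.drop_pos _) (by linarith), one_mul]
    rw [key, key, Equiv.sum_comp w (shift θ)]; rfl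
  · have key : ∀ σ : Equiv.Perm (Fin n), pathRe θ σ p.im = 0 := fun σ => by
      refine sum_eq_zero fun i _ => ?_
      have := level_antitone hθ σ (Nat.zero_le i)
      rw [level_zero] at this
      rw [ramp_of_nonpos (hθ.drop_pos _) (by linarith), zero_mul]
    rw [key, key]

theorem IsRhombicTiling.isWeakTiling (hθ : IsAdmissible θ) (hn : 0 < n) {w : Equiv.Perm (Fin n)}
    {T : Finset (Tile n)} (hT : IsRhombicTiling θ w T) : IsWeakTiling θ w T where
  nonoverlapping := hT.nonoverlapping
  subset_polygon _ ht := hT.covers ▸ Set.subset_biUnion_of_mem (u := fun t => t.carrier θ) ht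
  openPart_subset := hT.covers ▸ openPart_subset_polygon hθ hn w

theorem isWeakTiling_one : IsWeakTiling θ 1 ∅ where
  nonoverlapping := by simp
  subset_polygon := by simp
  openPart_subset := by
    rintro p ⟨h1, h2⟩
    exact absurd h2 h1.not_gt

section

variable {w : Equiv.Perm (Fin n)} {a : ℕ} {ha : a + 1 < n}

theorem polygon_exchange_subset (hθ : IsAdmissible θ) (hn : 0 < n)
    (hd : w ⟨a + 1, ha⟩ < w ⟨a, Nat.lt_of_succ_lt ha⟩) :
    polygon θ (exchange w a ha) ⊆ polygon θ w := by
  intro p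
  rw [mem_polygon_iff hθ hn, mem_polygon_iff hθ hn]
  rintro ⟨h1, h2, h3, h4⟩
  exact ⟨h1, h2, h3, h4.trans (pathRe_exchange_le hθ hd _)⟩

theorem descentTile_subset_polygon (hθ : IsAdmissible θ)
    (hd : w ⟨a + 1, ha⟩ < w ⟨a, Nat.lt_of_succ_lt ha⟩) :
    (descentTile w ha θ hd).carrier θ ⊆ polygon θ w := by
  intro p
  rw [mem_polygon_iff hθ (by omega), mem_descentTile_iff hd hθ]
  rintro ⟨h1, h2, h3, h4⟩
  refine ⟨?_, ?_, (pathRe_one_le hθ _ _).trans h3, h4⟩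
  · rw [← level_length w]
    exact (level_antitone hθ w (by omega)).trans h1
  · rw [← level_zero (θ := θ) w]
    exact h2.trans (level_antitone hθ w (Nat.zero_le _))

-- The old tiles stay left of the exchanged path and the new tile stays right of it; where the two
-- paths differ, the new tile fills precisely the gap.
open Classical in
theorem IsWeakTiling.insert_descentTile (hθ : IsAdmissible θ)
    (hd : w ⟨a + 1, ha⟩ < w ⟨a, Nat.lt_of_succ_lt ha⟩) {T : Finset (Tile n)}
    (hT : IsWeakTiling θ (exchange w a ha) T) :
    IsWeakTiling θ w (insert (descentTile w ha θ hd) T) := by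
  have hn : 0 < n := by omega
  have hdis : ∀ t ∈ T, Disjoint (interior (t.carrier θ))
      (interior ((descentTile w ha θ hd).carrier θ)) := by
    intro t ht
    rw [Set.disjoint_left]
    intro p h1 h2
    have h1 := hT.subset_polygon t ht (interior_subset h1)
    rw [mem_polygon_iff hθ hn] at h1
    rw [mem_interior_descentTile_iff hd hθ] at h2
    linarith [h1.2.2.2, h2.2.2.1]
  refine ⟨?_, ?_, ?_⟩
  · intro s hs t ht hst
    rw [mem_insert] at hs ht
    rcases hs with rfl | hs <;> rcases ht with rfl | ht
    · exact absurd rfl hst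
    · exact (hdis t ht).symm
    · exact hdis s hs
    · exact hT.nonoverlapping s hs t ht hst
  · intro t ht
    rw [mem_insert] at ht
    rcases ht with rfl | ht
    · exact descentTile_subset_polygon hθ hd
    · exact (hT.subset_polygon t ht).trans (polygon_exchange_subset hθ hn hd)
  · rintro p ⟨h1, h2⟩
    rw [set_biUnion_insert]
    rcases lt_or_ge p.re (pathRe θ (exchange w a ha) p.im) with h | h
    · exact Or.inr (hT.openPart_subset ⟨h1, h⟩)
    · left
      rw [mem_descentTile_iff hd hθ]
      by_contra hcon
      suffices p.im ≤ level θ w (a + 2) ∨ level θ w a ≤ p.im by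
        rw [pathRe_exchange_eq hθ hd this] at h
        linarith
      by_contra! hc
      exact hcon ⟨hc.1.le, hc.2.le, h, h2.le⟩

-- A remaining tile crossing the exchanged path would have an interior point in the descent tile,
-- hence would overlap its interior.
open Classical in
theorem IsWeakTiling.erase_descentTile (hθ : IsAdmissible θ)
    (hd : w ⟨a + 1, ha⟩ < w ⟨a, Nat.lt_of_succ_lt ha⟩) {T : Finset (Tile n)}
    (hT : IsWeakTiling θ w T) (hmem : descentTile w ha θ hd ∈ T) :
    IsWeakTiling θ (exchange w a ha) (T.erase (descentTile w ha θ hd)) := by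
  have hn : 0 < n := by omega
  refine ⟨fun s hs t ht => hT.nonoverlapping s (mem_of_mem_erase hs) t (mem_of_mem_erase ht),
    ?_, ?_⟩
  · intro s hs
    have hsT := mem_of_mem_erase hs
    rw [← s.closure_interior hθ]
    refine closure_minimal ?_ (isClosed_polygon hθ hn _)
    intro q hq
    have hqw := hT.subset_polygon s hsT (interior_subset hq)
    rw [mem_polygon_iff hθ hn] at hqw ⊢
    refine ⟨hqw.1, hqw.2.1, hqw.2.2.1, ?_⟩
    by_contra! hlt
    have hqt : q ∈ (descentTile w ha θ hd).carrier θ := by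
      rw [mem_descentTile_iff hd hθ]
      suffices ¬(q.im ≤ level θ w (a + 2) ∨ level θ w a ≤ q.im) by
        push Not at this
        exact ⟨this.1.le, this.2.le, hlt.le, hqw.2.2.2⟩
      intro hc
      rw [pathRe_exchange_eq hθ hd hc] at hlt
      linarith [hqw.2.2.2]
    rw [← Tile.closure_interior hθ, mem_closure_iff] at hqt
    obtain ⟨r, hr1, hr2⟩ := hqt _ isOpen_interior hq
    exact Set.disjoint_left.1 (hT.nonoverlapping s hsT _ hmem (ne_of_mem_erase hs)) hr1 hr2
  · rintro p ⟨h1, h2⟩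
    have hp := hT.openPart_subset ⟨h1, h2.trans_le (pathRe_exchange_le hθ hd _)⟩
    rw [Set.mem_iUnion₂] at hp ⊢
    obtain ⟨t, ht, hpt⟩ := hp
    refine ⟨t, mem_erase.2 ⟨?_, ht⟩, hpt⟩
    rintro rfl
    rw [mem_descentTile_iff hd hθ] at hpt
    linarith [hpt.2.2.1]

theorem openPart_nonempty (hθ : IsAdmissible θ)
    (hd : w ⟨a + 1, ha⟩ < w ⟨a, Nat.lt_of_succ_lt ha⟩) : (openPart θ w).Nonempty := by
  have hd' := (descentTile w ha θ hd).drop_pos hθ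
  obtain ⟨p, hp, -⟩ := (descentTile w ha θ hd).exists_mem_interior hθ
    (h := (descentTile w ha θ hd).top.im - (descentTile w ha θ hd).drop θ / 2)
    (by linarith) (by linarith)
  rw [mem_interior_descentTile_iff hd hθ] at hp
  exact ⟨p, (pathRe_one_le hθ _ _).trans_lt hp.2.2.1, hp.2.2.2⟩

end

theorem exists_isWeakTiling (hθ : IsAdmissible θ) (w : Equiv.Perm (Fin n)) :
    ∃ T, IsWeakTiling θ w T := by
  classical
  induction w using descent_induction with
  | one => exact ⟨∅, isWeakTiling_one⟩
  | step w a ha hd ih =>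
    obtain ⟨T, hT⟩ := ih
    exact ⟨_, hT.insert_descentTile hθ hd⟩

/-! ### Weak tilings of polygons without degenerate part -/

/-- If the two boundary paths meet at the height of an inner point of an edge of the rightside
boundary, then `w` stabilizes the positions above this edge and the position of this edge. -/
theorem image_eq_of_pathRe_eq (hθ : IsAdmissible θ) (w : Equiv.Perm (Fin n)) {j : ℕ} (hj : j < n)
    {h : ℝ} (h1 : level θ w (j + 1) < h) (h2 : h < level θ w j)
    (he : pathRe θ 1 h = pathRe θ w h) :
    w '' {i : Fin n | (i : ℕ) < j} = {i : Fin n | (i : ℕ) < j} ∧ w ⟨j, hj⟩ = ⟨j, hj⟩ := by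
  induction w using descent_induction with
  | one => simp
  | step w a ha hd ih =>
    have hle := pathRe_one_le hθ (exchange w a ha) h
    -- Within the vertical range of the descent tile the exchange moves the path strictly left, to
    -- where it would have to cross the leftside boundary. So edge `j` is neither of the two
    -- exchanged edges.
    have hcase : a + 2 ≤ j ∨ j + 1 ≤ a := by
      by_contra! hc
      have := pathRe_exchange_lt hθ hd (h := h)
        ((level_antitone hθ w (show j + 1 ≤ a + 2 by omega)).trans_lt h1)
        (h2.trans_le (level_antitone hθ w (show a ≤ j by omega)))
      linarith
    have hle' := pathRe_exchange_le hθ hd h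
    obtain ⟨i1, i2⟩ := ih (by rwa [level_exchange w ha (by omega)])
      (by rwa [level_exchange w ha (by omega)]) (by linarith)
    rw [exchange_of_ne w ha (by dsimp only; omega) (by dsimp only; omega)] at i2
    refine ⟨?_, i2⟩
    have hset : (Equiv.swap (⟨a, Nat.lt_of_succ_lt ha⟩ : Fin n) ⟨a + 1, ha⟩) ''
        {i : Fin n | (i : ℕ) < j} = {i : Fin n | (i : ℕ) < j} := by
      rw [Equiv.image_eq_preimage_symm, Equiv.symm_swap]
      ext i
      simp only [Set.mem_preimage, Set.mem_ofPred_eq]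
      rcases eq_or_ne i ⟨a, Nat.lt_of_succ_lt ha⟩ with rfl | g1
      · rw [Equiv.swap_apply_left]; dsimp only; omega
      rcases eq_or_ne i ⟨a + 1, ha⟩ with rfl | g2
      · rw [Equiv.swap_apply_right]; dsimp only; omega
      rw [Equiv.swap_apply_of_ne_of_ne g1 g2]
    rw [exchange, Equiv.Perm.coe_mul, Set.image_comp, hset] at i1
    exact i1

theorem FullySupported.pathRe_lt (hθ : IsAdmissible θ) {w : Equiv.Perm (Fin n)}
    (hw : FullySupported w) (hn : 2 ≤ n) {h : ℝ} (h1 : level θ 1 n < h) (h2 : h < 0)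
    (hh : ∀ k, h ≠ level θ w k) : pathRe θ 1 h < pathRe θ w h := by
  refine lt_of_le_of_ne (pathRe_one_le hθ w h) fun he => ?_
  obtain ⟨j, hj, g1, g2⟩ := exists_level_lt_le (θ := θ) w
    (by rw [level_length]; exact h1.le) h2
  obtain ⟨i1, i2⟩ := image_eq_of_pathRe_eq hθ w hj (lt_of_le_of_ne g1 (hh _).symm) g2 he
  -- For `j = 0` the set of positions above the edge is empty and says nothing; the fixed position
  -- `0` contradicts full support at `r = 1` instead.
  rcases Nat.eq_zero_or_pos j with rfl | hj0
  · refine hw 1 one_pos (by omega) ?_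
    have : {i : Fin n | (i : ℕ) < 1} = {⟨0, hj⟩} := by
      ext i; simp [Fin.ext_iff]
    rw [this, Set.image_singleton, i2]
  · exact hw j hj0 hj i1

/-- The paths can touch only at finitely many heights, those of vertices and the two extremes. Every
point is a limit of points at other heights and at a fraction strictly between `0` and `1` of the
width. -/
theorem FullySupported.polygon_subset_closure (hθ : IsAdmissible θ) {w : Equiv.Perm (Fin n)}
    (hw : FullySupported w) (hn : 2 ≤ n) : polygon θ w ⊆ closure (openPart θ w) := by
  intro p hp
  rw [mem_polygon_iff hθ (by omega)] at hp
  obtain ⟨h1, h2, h3, h4⟩ := hp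
  have hfin : (Set.range fun k : Fin (n + 1) => level θ w k).Finite := Set.finite_range _
  have hneg : level θ 1 n < 0 := by
    rw [← level_zero (θ := θ) 1]; exact level_lt hθ 1 (by omega) le_rfl
  set A : Set ℝ := Set.Ioo (level θ 1 n) 0 ∩ (Set.range fun k : Fin (n + 1) => level θ w k)ᶜ
  have hA : p.im ∈ closure A := by
    have := (hfin.countable.dense_compl ℝ).open_subset_closure_inter
      (isOpen_Ioo (a := level θ 1 n) (b := 0))
    have := closure_minimal this isClosed_closure
    rw [closure_Ioo hneg.ne] at this
    exact this ⟨h1, h2⟩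
  obtain ⟨m, hm, hpm⟩ : ∃ m ∈ Set.Icc (0 : ℝ) 1,
      p.re = pathRe θ 1 p.im + m * (pathRe θ w p.im - pathRe θ 1 p.im) := by
    rcases (h3.trans h4).lt_or_eq with hlt | heq
    · refine ⟨(p.re - pathRe θ 1 p.im) / (pathRe θ w p.im - pathRe θ 1 p.im),
        ⟨div_nonneg (by linarith) (by linarith), (div_le_one (by linarith)).2 (by linarith)⟩, ?_⟩
      have : pathRe θ w p.im - pathRe θ 1 p.im ≠ 0 := by linarith
      field_simp; ring
    · exact ⟨0, by simp, by linarith⟩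
  rw [← closure_Ioo zero_ne_one] at hm
  have c1 := continuous_pathRe (θ := θ) 1
  have c2 := continuous_pathRe (θ := θ) w
  let f : ℝ × ℝ → ℂ := fun q =>
    ((pathRe θ 1 q.1 + q.2 * (pathRe θ w q.1 - pathRe θ 1 q.1) : ℝ) : ℂ) + (q.1 : ℂ) * Complex.I
  have hf : Continuous f := by
    have : Continuous fun q : ℝ × ℝ =>
      pathRe θ 1 q.1 + q.2 * (pathRe θ w q.1 - pathRe θ 1 q.1) := by fun_prop
    exact (Complex.continuous_ofReal.comp this).add
      ((Complex.continuous_ofReal.comp continuous_fst).mul continuous_const)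
  have hp : p = f (p.im, m) := by
    apply Complex.ext <;> simp [f, hpm]
  have hmem : (p.im, m) ∈ closure (A ×ˢ Set.Ioo (0 : ℝ) 1) := by
    rw [closure_prod_eq]; exact ⟨hA, hm⟩
  rw [hp]
  refine closure_mono ?_ (image_closure_subset_closure_image hf (Set.mem_image_of_mem f hmem))
  rintro _ ⟨⟨h, m⟩, ⟨⟨⟨g1, g2⟩, g3⟩, m0, m1⟩, rfl⟩
  dsimp only at g1 g2 g3 m0 m1
  have hlt := hw.pathRe_lt hθ hn g1 g2 (by
    intro k hk
    rcases le_or_gt k n with hkn | hkn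
    · exact g3 ⟨⟨k, by omega⟩, hk.symm⟩
    · have := level_antitone hθ w hkn.le
      rw [level_length] at this
      linarith)
  have e1 : (f (h, m)).re = pathRe θ 1 h + m * (pathRe θ w h - pathRe θ 1 h) := by simp [f]
  have e2 : (f (h, m)).im = h := by simp [f]
  change pathRe θ 1 _ < _ ∧ _ < pathRe θ w _
  rw [e1, e2]
  constructor <;> nlinarith

theorem IsWeakTiling.isRhombicTiling (hθ : IsAdmissible θ) {w : Equiv.Perm (Fin n)}
    (hw : FullySupported w) (hn : 2 ≤ n) {T : Finset (Tile n)} (hT : IsWeakTiling θ w T) :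
    IsRhombicTiling θ w T where
  nonoverlapping := hT.nonoverlapping
  covers := by
    refine Set.Subset.antisymm (Set.iUnion₂_subset hT.subset_polygon) ?_
    refine (hw.polygon_subset_closure hθ hn).trans (closure_minimal hT.openPart_subset ?_)
    exact T.finite_toSet.isClosed_biUnion fun t _ => t.isClosed_carrier hθ

/-! ### The rightmost tile of a family -/

/-- Some inner point of `s` lies horizontally to the left of some inner point of `t`. -/
def Tile.LeftOf (θ : Fin n → ℝ) (s t : Tile n) : Prop :=
  ∃ p ∈ interior (s.carrier θ), ∃ q ∈ interior (t.carrier θ), p.im = q.im ∧ p.re < q.re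

/-- A linear functional `f` separates the two disjoint open convex sets. On points of equal height
it differs by the horizontal distance times `f 1`, so a single comparison fixes the sign of `f 1`
and thereby every comparison. -/
theorem Tile.LeftOf.re_lt {s t : Tile n} (h : s.LeftOf θ t)
    (hdis : Disjoint (interior (s.carrier θ)) (interior (t.carrier θ))) {p q : ℂ}
    (hp : p ∈ interior (s.carrier θ)) (hq : q ∈ interior (t.carrier θ)) (him : p.im = q.im) :
    p.re < q.re := by
  obtain ⟨p', hp', q', hq', him', hlt⟩ := h
  obtain ⟨f, u, h1, h2⟩ := geometric_hahn_banach_open_open s.convex_carrier.interior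
    isOpen_interior t.convex_carrier.interior isOpen_interior hdis
  have key : ∀ {a b : ℂ}, a.im = b.im → f b - f a = (b.re - a.re) * f 1 := by
    intro a b hab
    have : b - a = (b.re - a.re) • (1 : ℂ) := by
      apply Complex.ext <;> simp [hab]
    rw [← map_sub, this, map_smul, smul_eq_mul]
  have k1 := key him'
  have k2 := key him
  have l1 := h1 _ hp
  have l2 := h2 _ hq
  have l3 := h1 _ hp'
  have l4 := h2 _ hq'
  have hf : 0 < f 1 := by
    have : 0 < (q'.re - p'.re) * f 1 := by linarith
    exact (mul_pos_iff_of_pos_left (by linarith)).1 this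
  have : 0 < (q.re - p.re) * f 1 := by linarith
  linarith [(mul_pos_iff_of_pos_right hf).1 this]

/-- `LeftOf` need not be transitive, since two tiles may share no height. Inserting tiles in order
of decreasing top makes it transitive through the newest tile, whose top is lowest. -/
theorem exists_rightmost (hθ : IsAdmissible θ) (T : Finset (Tile n))
    (hT : ∀ s ∈ T, ∀ t ∈ T, s ≠ t →
      Disjoint (interior (s.carrier θ)) (interior (t.carrier θ))) (hne : T.Nonempty) :
    ∃ t ∈ T, ∀ s ∈ T, s ≠ t → ¬ t.LeftOf θ s := by
  classical
  induction T using Finset.induction_on_min_value (fun t : Tile n => t.top.im) with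
  | empty => exact absurd hne (by simp)
  | insert a T haT hmin ih =>
    rcases T.eq_empty_or_nonempty with rfl | hTne
    · refine ⟨a, by simp, ?_⟩
      intro s hs hsa
      simp at hs
      exact absurd hs hsa
    obtain ⟨m, hm, hmax⟩ := ih
      (fun s hs t ht => hT s (mem_insert_of_mem hs) t (mem_insert_of_mem ht)) hTne
    have hma : m ≠ a := fun h => haT (h ▸ hm)
    by_cases hlt : m.LeftOf θ a
    · refine ⟨a, mem_insert_self _ _, ?_⟩
      intro u hu hua hau
      have hu : u ∈ T := (mem_insert.1 hu).resolve_left hua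
      have dma := hT m (mem_insert_of_mem hm) a (mem_insert_self _ _) hma
      have dau := hT a (mem_insert_self _ _) u (mem_insert_of_mem hu) hua.symm
      by_cases hum : u = m
      · subst hum
        obtain ⟨p, hp, q, hq, him, h⟩ := hlt
        exact lt_asymm h (hau.re_lt dau hq hp him.symm)
      refine hmax u hu hum ?_
      -- The larger of the two witness heights lies above the bottoms of `m`, `a` and `u`, and below
      -- all their tops because `a` has the lowest top. Comparing there gives `m` left of `u`.
      obtain ⟨p, hp, q, hq, him, -⟩ := id hlt
      obtain ⟨p', hp', q', hq', him', -⟩ := id hau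
      rw [Tile.mem_interior_iff hθ] at hp hq hp' hq'
      have m1 := hmin m hm
      have m2 := hmin u hu
      have b1 : m.top.im - m.drop θ < max p.im p'.im := hp.1.trans_le (le_max_left _ _)
      have b2 : max p.im p'.im < a.top.im := max_lt (him ▸ hq.2.1) hp'.2.1
      have b3 : a.top.im - a.drop θ < max p.im p'.im := hp'.1.trans_le (le_max_right _ _)
      have b4 : u.top.im - u.drop θ < max p.im p'.im :=
        (him' ▸ hq'.1).trans_le (le_max_right _ _)
      obtain ⟨x, hx, ex⟩ := m.exists_mem_interior hθ b1 (b2.trans_le m1)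
      obtain ⟨y, hy, ey⟩ := a.exists_mem_interior hθ b3 b2
      obtain ⟨z, hz, ez⟩ := u.exists_mem_interior hθ b4 (b2.trans_le m2)
      exact ⟨x, hx, z, hz, ex.trans ez.symm, (hlt.re_lt dma hx hy (ex.trans ey.symm)).trans
        (hau.re_lt dau hy hz (ey.trans ez.symm))⟩
    · refine ⟨m, mem_insert_of_mem hm, ?_⟩
      intro s hs hsm
      rcases mem_insert.1 hs with rfl | hs
      · exact hlt
      · exact hmax s hs hsm

/-- The right side of the rightmost tile is part of the rightside boundary. -/
theorem IsWeakTiling.rightRe_eq_pathRe (hθ : IsAdmissible θ) (hn : 0 < n)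
    {w : Equiv.Perm (Fin n)} {T : Finset (Tile n)} (hT : IsWeakTiling θ w T) {t : Tile n}
    (ht : t ∈ T) (hmax : ∀ s ∈ T, s ≠ t → ¬ t.LeftOf θ s) {h : ℝ}
    (h1 : t.top.im - t.drop θ < h) (h2 : h < t.top.im) : t.rightRe θ h = pathRe θ w h := by
  have hlr := t.leftRe_lt_rightRe hθ h2 h1
  have hp : (⟨t.rightRe θ h, h⟩ : ℂ) ∈ polygon θ w :=
    hT.subset_polygon t ht ((t.mem_carrier_iff hθ _).2 ⟨h1.le, h2.le, hlr.le, le_rfl⟩)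
  rw [mem_polygon_iff hθ hn] at hp
  obtain ⟨-, -, hp3, hp4⟩ := hp
  dsimp only at hp3 hp4
  refine le_antisymm hp4 ?_
  by_contra! hlt
  set m : ℂ := ⟨(t.rightRe θ h + pathRe θ w h) / 2, h⟩ with hm
  have hmo : m ∈ openPart θ w := by
    change pathRe θ 1 h < _ ∧ _ < pathRe θ w h
    rw [hm]; constructor <;> dsimp only <;> linarith
  obtain ⟨s, hs, hms⟩ := Set.mem_iUnion₂.1 (hT.openPart_subset hmo)
  have hc := t.continuous_rightRe (θ := θ)
  have c1 := Complex.continuous_im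
  have c2 := Complex.continuous_re
  -- A tile containing `m` also has interior points near `m`, still right of `t` and at heights of
  -- `t`; this contradicts the choice of `t`.
  have hopen : IsOpen ({q : ℂ | t.top.im - t.drop θ < q.im} ∩ {q | q.im < t.top.im} ∩
      {q | t.rightRe θ q.im < q.re}) :=
    ((isOpen_lt (by fun_prop) (by fun_prop)).inter (isOpen_lt (by fun_prop) (by fun_prop))).inter
      (isOpen_lt (by fun_prop) (by fun_prop))
  have hmN : m ∈ ({q : ℂ | t.top.im - t.drop θ < q.im} ∩ {q | q.im < t.top.im} ∩
      {q | t.rightRe θ q.im < q.re}) := by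
    refine ⟨⟨h1, h2⟩, ?_⟩
    change t.rightRe θ h < (t.rightRe θ h + pathRe θ w h) / 2
    linarith
  have hst : s ≠ t := by
    rintro rfl
    have := ((s.mem_carrier_iff hθ m).1 hms).2.2.2
    exact absurd hmN.2 (not_lt.2 this)
  rw [← s.closure_interior hθ, mem_closure_iff] at hms
  obtain ⟨q, ⟨⟨q1, q2⟩, q3⟩, hq⟩ := hms _ hopen hmN
  obtain ⟨p, hp, hpq⟩ := t.exists_mem_interior hθ q1 q2
  refine hmax s hs hst ⟨p, hp, q, hq, hpq, ?_⟩
  have := ((t.mem_interior_iff hθ p).1 hp).2.2.2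
  rw [hpq] at this
  exact this.trans q3

/-- If a path runs along a segment of label `l` between the heights `h` and `h'`, and one of its
edges has points strictly between these heights, then this edge has label `l`. -/
theorem label_eq_of_pathRe_affine (hθ : IsAdmissible θ) (w : Equiv.Perm (Fin n)) {l : Fin n}
    {c h h' : ℝ} (haff : ∀ y, h < y → y < h' → pathRe θ w y = c - y / drop θ l * shift θ l)
    {i : ℕ} (hi : i < n) (h1 : level θ w (i + 1) < h') (h2 : h < level θ w i) (hh : h < h') :
    w ⟨i, hi⟩ = l := by
  have hlv := level_lt hθ w i.lt_succ_self hi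
  obtain ⟨y, y1, y2⟩ := exists_between
    (show max h (level θ w (i + 1)) < min h' (level θ w i) from
      max_lt (lt_min hh h2) (lt_min h1 hlv))
  obtain ⟨z, z1, z2⟩ := exists_between y2
  rw [max_lt_iff] at y1
  rw [lt_min_iff] at z2 y2
  have ey := haff y y1.1 y2.1
  have ez := haff z (y1.1.trans z1) z2.1
  rw [pathRe_of_mem hθ w hi y1.2.le y2.2.le] at ey
  rw [pathRe_of_mem hθ w hi (y1.2.trans z1).le z2.2.le] at ez
  refine hθ.eq_of_slope_eq ?_
  have hyz : z - y ≠ 0 := by linarith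
  refine mul_left_cancel₀ hyz ?_
  have e : (z - y) * (shift θ (w ⟨i, hi⟩) / drop θ (w ⟨i, hi⟩)) =
    (level θ w i - y) / drop θ (w ⟨i, hi⟩) * shift θ (w ⟨i, hi⟩) -
    (level θ w i - z) / drop θ (w ⟨i, hi⟩) * shift θ (w ⟨i, hi⟩) := by ring
  rw [e]
  have e' : (z - y) * (shift θ l / drop θ l) =
    z / drop θ l * shift θ l - y / drop θ l * shift θ l := by ring
  rw [e']
  linarith

/-- Every weak tiling with at least one tile contains a tile at a descent. -/
theorem IsWeakTiling.exists_descentTile_mem (hθ : IsAdmissible θ) {w : Equiv.Perm (Fin n)}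
    {T : Finset (Tile n)} (hT : IsWeakTiling θ w T) (hne : T.Nonempty) :
    ∃ a, ∃ ha : a + 1 < n, ∃ hd : w ⟨a + 1, ha⟩ < w ⟨a, Nat.lt_of_succ_lt ha⟩,
      descentTile w ha θ hd ∈ T := by
  obtain ⟨t, ht, hmax⟩ := exists_rightmost hθ T hT.nonoverlapping hne
  have hn : 0 < n := t.lo.pos
  have hR := fun {h : ℝ} => hT.rightRe_eq_pathRe hθ hn ht hmax (h := h)
  have dl := hθ.drop_pos t.lo
  have dh := hθ.drop_pos t.hi
  have hdrop : t.drop θ = drop θ t.lo + drop θ t.hi := rfl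
  have htop : t.top.im ≤ 0 ∧ level θ w n ≤ t.top.im - t.drop θ := by
    have hmemtop : t.top ∈ t.carrier θ := ⟨0, by simp, 0, by simp, by simp⟩
    have hmembot : t.top + edgeVec θ t.lo + edgeVec θ t.hi ∈ t.carrier θ :=
      ⟨1, by simp, 1, by simp, by simp⟩
    have h1 := (mem_polygon_iff hθ hn w _).1 (hT.subset_polygon t ht hmemtop)
    have h2 := (mem_polygon_iff hθ hn w _).1 (hT.subset_polygon t ht hmembot)
    refine ⟨h1.2.1, ?_⟩
    rw [level_length, hdrop]
    have := h2.1
    simp only [Complex.add_im] at this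
    simp only [drop]
    linarith
  have aff1 : ∀ y, t.top.im - drop θ t.hi < y → y < t.top.im → pathRe θ w y =
      (t.top.re + t.top.im / drop θ t.hi * shift θ t.hi) -
        y / drop θ t.hi * shift θ t.hi := by
    intro y y1 y2
    rw [← hR (by linarith) y2, Tile.rightRe, bend_of_le dh dl (by linarith) (by linarith)]
    ring
  have aff2 : ∀ y, t.top.im - t.drop θ < y → y < t.top.im - drop θ t.hi → pathRe θ w y =
      (t.top.re + shift θ t.hi + (t.top.im - drop θ t.hi) / drop θ t.lo * shift θ t.lo) -
        y / drop θ t.lo * shift θ t.lo := by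
    intro y y1 y2
    rw [← hR y1 (by linarith), Tile.rightRe, bend_of_ge dh dl (by linarith) (by linarith)]
    ring
  -- The edge at half the height of the upper right side of `t`; its slope forces the label `t.hi`.
  obtain ⟨i, hi, i1, i2⟩ := exists_level_lt_le w (θ := θ)
    (h := t.top.im - drop θ t.hi / 2) (by linarith) (by linarith)
  have lab1 : ∀ {j : ℕ} (hj : j < n), level θ w (j + 1) < t.top.im →
      t.top.im - drop θ t.hi < level θ w j → w ⟨j, hj⟩ = t.hi := fun hj h1 h2 =>
    label_eq_of_pathRe_affine hθ w aff1 hj h1 h2 (by linarith)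
  have hwi := lab1 hi (by linarith) (by linarith)
  have hls := level_succ (θ := θ) w hi
  rw [hwi] at hls
  -- If edge `i` began below the top of `t`, its predecessor would also carry the label `t.hi`,
  -- contrary to injectivity of `w`. The same argument applies at its lower end.
  have hi1 : t.top.im ≤ level θ w i := by
    by_contra! hlt
    rcases Nat.eq_zero_or_pos i with rfl | hi0
    · rw [level_zero] at hlt; linarith
    · obtain ⟨j, rfl⟩ : ∃ j, i = j + 1 := ⟨i - 1, by omega⟩
      have := lab1 (j := j) (by omega) hlt
        (by linarith [level_lt hθ w j.lt_succ_self (by omega)])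
      have := w.injective (this.trans hwi.symm)
      simp [Fin.ext_iff] at this
  have hbot : level θ w n < level θ w (i + 1) := by linarith
  have hin : i + 1 < n := by
    rcases Nat.lt_or_ge (i + 1) n with h | h
    · exact h
    · exact absurd (level_antitone hθ w h) (not_le.2 hbot)
  have hi2 : level θ w (i + 1) ≤ t.top.im - drop θ t.hi := by
    by_contra! hlt
    have := lab1 hin (by linarith [level_lt hθ w (i + 1).lt_succ_self hin]) hlt
    have := w.injective (this.trans hwi.symm)
    simp [Fin.ext_iff] at this
  have hlev : level θ w i = t.top.im := by linarith
  have hwi' : w ⟨i + 1, hin⟩ = t.lo :=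
    label_eq_of_pathRe_affine hθ w aff2 hin
      (by linarith [level_lt hθ w (i + 1).lt_succ_self hin]) (by linarith) (by linarith)
  refine ⟨i, hin, by rw [hwi, hwi']; exact t.lo_lt_hi, ?_⟩
  convert ht
  have hre : (pathVertex θ w i).re = t.top.re := by
    have := aff1 (t.top.im - drop θ t.hi / 2) (by linarith) (by linarith)
    rw [pathRe_of_mem hθ w hi (by linarith) (by linarith), hwi, hlev] at this
    ring_nf at this
    linarith
  have hV : pathVertex θ w i = t.top := Complex.ext hre hlev
  simp only [descentTile, hV, hwi, hwi']

/-! ### Forced and avoidable tiles -/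

/-- The tile at a descent formed by a left-to-right maximum and a right-to-left minimum occurs in
every weak tiling. -/
theorem IsWeakTiling.descentTile_mem (hθ : IsAdmissible θ) {w : Equiv.Perm (Fin n)}
    {T : Finset (Tile n)} (hT : IsWeakTiling θ w T) {k : ℕ} (hk : k + 1 < n)
    (hd : w ⟨k + 1, hk⟩ < w ⟨k, Nat.lt_of_succ_lt hk⟩)
    (hmax : ∀ j : Fin n, (j : ℕ) < k → w j < w ⟨k, Nat.lt_of_succ_lt hk⟩)
    (hmin : ∀ j : Fin n, k + 1 < (j : ℕ) → w ⟨k + 1, hk⟩ < w j) :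
    descentTile w hk θ hd ∈ T := by
  classical
  induction hm : #T generalizing T w with
  | zero =>
    obtain ⟨p, hp⟩ := openPart_nonempty hθ hd
    have := hT.openPart_subset hp
    rw [card_eq_zero.1 hm] at this
    simp at this
  | succ m ih =>
    obtain ⟨a, ha, hda, hmem⟩ := hT.exists_descentTile_mem hθ (card_pos.1 (by omega))
    by_cases hak : a = k
    · subst hak; exact hmem
    -- A descent overlapping position `k` or `k + 1` in one place would contradict `hmin` or `hmax`.
    have hak1 : a ≠ k + 1 := by
      rintro rfl
      exact lt_asymm hda (hmin ⟨k + 1 + 1, ha⟩ (by simp))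
    have hak2 : a + 1 ≠ k := by
      rintro rfl
      exact lt_asymm hda (hmax ⟨a, _⟩ (by simp))
    have e1 : exchange w a ha ⟨k, Nat.lt_of_succ_lt hk⟩ = w ⟨k, Nat.lt_of_succ_lt hk⟩ :=
      exchange_of_ne w ha (Ne.symm hak) (Ne.symm hak2)
    have e2 : exchange w a ha ⟨k + 1, hk⟩ = w ⟨k + 1, hk⟩ :=
      exchange_of_ne w ha (Ne.symm hak1) (by dsimp only; omega)
    -- Both exchanged positions lie on the same side of the descent, so the entries before it, and
    -- those after it, are merely permuted.
    have hswap : ∀ (P : ℕ → Prop), (P a ↔ P (a + 1)) → (∀ j : Fin n, P j →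
        ∃ j' : Fin n, P j' ∧ exchange w a ha j = w j') := by
      intro P hP j hj
      refine ⟨Equiv.swap ⟨a, Nat.lt_of_succ_lt ha⟩ ⟨a + 1, ha⟩ j, ?_, rfl⟩
      rcases eq_or_ne j ⟨a, Nat.lt_of_succ_lt ha⟩ with rfl | g1
      · rw [Equiv.swap_apply_left]; exact hP.1 hj
      rcases eq_or_ne j ⟨a + 1, ha⟩ with rfl | g2
      · rw [Equiv.swap_apply_right]; exact hP.2 hj
      rwa [Equiv.swap_apply_of_ne_of_ne g1 g2]
    have := ih (hT.erase_descentTile hθ hda hmem) (by rw [e1, e2]; exact hd)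
      (fun j hj => by
        obtain ⟨j', hj', e⟩ := hswap (· < k) (by omega) j hj
        rw [e, e1]; exact hmax j' hj')
      (fun j hj => by
        obtain ⟨j', hj', e⟩ := hswap (k + 1 < ·) (by omega) j hj
        rw [e, e2]; exact hmin j' hj')
      (by rw [card_erase_of_mem hmem, hm]; rfl)
    have hmem' := mem_of_mem_erase this
    convert hmem' using 1
    simp only [descentTile, pathVertex_exchange w ha (Ne.symm hak2), e1, e2]

/-- The midpoint of the `k`-th edge of a path. -/
def edgeMid (θ : Fin n → ℝ) (w : Equiv.Perm (Fin n)) {k : ℕ} (hk : k < n) : ℂ :=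
  pathVertex θ w k + (2⁻¹ : ℝ) • edgeVec θ (w ⟨k, hk⟩)

theorem edgeMid_im (w : Equiv.Perm (Fin n)) {k : ℕ} (hk : k < n) :
    (edgeMid θ w hk).im = level θ w k - drop θ (w ⟨k, hk⟩) / 2 := by
  simp [edgeMid, level, drop]; ring

theorem edgeMid_re (hθ : IsAdmissible θ) (w : Equiv.Perm (Fin n)) {k : ℕ} (hk : k < n) :
    (edgeMid θ w hk).re = pathRe θ w (edgeMid θ w hk).im := by
  have hd := hθ.drop_pos (w ⟨k, hk⟩)
  have := level_succ (θ := θ) w hk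
  rw [edgeMid_im, pathRe_of_mem hθ w hk (by linarith) (by linarith), sub_sub_cancel,
    div_div_cancel_left' hd.ne']
  simp [edgeMid, shift]

theorem edgeMid_mem_pathEdge (hθ : IsAdmissible θ) (w : Equiv.Perm (Fin n)) {k : ℕ} (hk : k < n) :
    edgeMid θ w hk ∈ pathEdge θ w k := by
  have hd := hθ.drop_pos (w ⟨k, hk⟩)
  have := level_succ (θ := θ) w hk
  rw [mem_pathEdge_iff hθ w hk]
  refine ⟨?_, ?_, edgeMid_re hθ w hk⟩ <;> rw [edgeMid_im] <;> linarith

/-- The midpoint lies on the rightside boundary at a height where the exchange moves that boundary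
strictly inwards. -/
theorem edgeMid_notMem_polygon_exchange (hθ : IsAdmissible θ) (w : Equiv.Perm (Fin n)) {a : ℕ}
    (ha : a + 1 < n) (hd : w ⟨a + 1, ha⟩ < w ⟨a, Nat.lt_of_succ_lt ha⟩) {k : ℕ} (hk : k < n)
    (hka : k = a ∨ k = a + 1) : edgeMid θ w hk ∉ polygon θ (exchange w a ha) := by
  rw [mem_polygon_iff hθ (by omega), edgeMid_re hθ]
  rintro ⟨-, -, -, h⟩
  have hd' := hθ.drop_pos (w ⟨k, hk⟩)
  have := level_succ (θ := θ) w hk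
  have l1 := level_antitone hθ w (show k + 1 ≤ a + 2 by omega)
  have l2 := level_antitone hθ w (show a ≤ k by omega)
  refine absurd (pathRe_exchange_lt hθ hd ?_ ?_) (not_lt.2 h) <;> rw [edgeMid_im] <;> linarith

/-- If a larger label occurs above the `k`-th edge of the rightside boundary, then every tile that
contains the midpoint of this edge and has its label as larger label can be avoided. -/
theorem exists_isWeakTiling_notMem_of_lt (hθ : IsAdmissible θ) {τ : Tile n} {k : ℕ} (hk : k < n)
    (w : Equiv.Perm (Fin n)) (hτ : τ.hi = w ⟨k, hk⟩) (hmid : edgeMid θ w hk ∈ τ.carrier θ)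
    (a : ℕ) (hak : a < k) (haw : w ⟨k, hk⟩ < w ⟨a, hak.trans hk⟩) :
    ∃ T, IsWeakTiling θ w T ∧ τ ∉ T := by
  classical
  induction hm : k - a generalizing a w with
  | zero => omega
  | succ m ih =>
    by_cases hlast : a + 1 = k
    · subst hlast
      -- The added tile has the larger label `w a`, not `w k`, and all other tiles lie in a polygon
      -- that misses the midpoint of the edge.
      obtain ⟨T, hT⟩ := exists_isWeakTiling hθ (exchange w a hk)
      refine ⟨_, hT.insert_descentTile hθ haw, ?_⟩
      rw [mem_insert, not_or]
      constructor
      · intro e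
        rw [e] at hτ
        exact haw.ne' hτ
      · exact fun hmem => edgeMid_notMem_polygon_exchange hθ w hk haw hk (Or.inr rfl)
          (hT.subset_polygon τ hmem hmid)
    have ha1 : a + 1 < n := by omega
    -- Either the next entry is itself larger than `w k` and replaces the witness, or the witness
    -- passes it by a descent exchange. The latter leaves edge `k` in place.
    rcases lt_or_ge (w ⟨k, hk⟩) (w ⟨a + 1, ha1⟩) with h | h
    · exact ih w hτ hmid (a + 1) (by omega) h (by omega)
    · have hd := h.trans_lt haw
      have ek : exchange w a ha1 ⟨k, hk⟩ = w ⟨k, hk⟩ :=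
        exchange_of_ne w ha1 (by dsimp only; omega) (by dsimp only; omega)
      have em : edgeMid θ (exchange w a ha1) hk = edgeMid θ w hk := by
        rw [edgeMid, edgeMid, ek, pathVertex_exchange w ha1 (by omega)]
      obtain ⟨T, hT, hτT⟩ := ih (exchange w a ha1) (hτ.trans ek.symm) (em ▸ hmid) (a + 1)
        (by omega) (by rw [ek, exchange_right]; exact haw) (by omega)
      refine ⟨_, hT.insert_descentTile hθ hd, ?_⟩
      rw [mem_insert, not_or]
      refine ⟨?_, hτT⟩
      intro e
      rw [e] at hτ
      exact haw.ne' hτ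

/-- If a smaller label occurs below the `k`-th edge of the rightside boundary, then every tile that
contains the midpoint of this edge and has its label as smaller label can be avoided. -/
theorem exists_isWeakTiling_notMem_of_gt (hθ : IsAdmissible θ) {τ : Tile n} {k : ℕ} (hk : k < n)
    (w : Equiv.Perm (Fin n)) (hτ : τ.lo = w ⟨k, hk⟩) (hmid : edgeMid θ w hk ∈ τ.carrier θ)
    (c : ℕ) (hc : c < n) (hkc : k < c) (hcw : w ⟨c, hc⟩ < w ⟨k, hk⟩) :
    ∃ T, IsWeakTiling θ w T ∧ τ ∉ T := by
  classical
  induction hm : c - k generalizing w c with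
  | zero => omega
  | succ m ih =>
    obtain ⟨c, rfl⟩ : ∃ c', c = c' + 1 := ⟨c - 1, by omega⟩
    by_cases hlast : k = c
    · subst hlast
      obtain ⟨T, hT⟩ := exists_isWeakTiling hθ (exchange w k hc)
      refine ⟨_, hT.insert_descentTile hθ hcw, ?_⟩
      rw [mem_insert, not_or]
      constructor
      · intro e
        rw [e] at hτ
        exact hcw.ne hτ
      · exact fun hmem => edgeMid_notMem_polygon_exchange hθ w hc hcw hk (Or.inl rfl)
          (hT.subset_polygon τ hmem hmid)
    rcases lt_or_ge (w ⟨c, by omega⟩) (w ⟨k, hk⟩) with h | h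
    · exact ih w hτ hmid c (by omega) (by omega) h (by omega)
    · have hd := hcw.trans_le h
      have ek : exchange w c hc ⟨k, hk⟩ = w ⟨k, hk⟩ :=
        exchange_of_ne w hc (by dsimp only; omega) (by dsimp only; omega)
      have em : edgeMid θ (exchange w c hc) hk = edgeMid θ w hk := by
        rw [edgeMid, edgeMid, ek, pathVertex_exchange w hc (by omega)]
      obtain ⟨T, hT, hτT⟩ := ih (exchange w c hc) (hτ.trans ek.symm) (em ▸ hmid) c
        (by omega) (by omega) (by rw [ek, exchange_left]; exact hcw) (by omega)
      refine ⟨_, hT.insert_descentTile hθ hd, ?_⟩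
      rw [mem_insert, not_or]
      refine ⟨?_, hτT⟩
      intro e
      rw [e] at hτ
      exact hcw.ne hτ

/-! ### Right-perimeter tiles -/

theorem descentTile_isRightPerimeter {w : Equiv.Perm (Fin n)} {k : ℕ} {hk : k + 1 < n}
    (hd : w ⟨k + 1, hk⟩ < w ⟨k, Nat.lt_of_succ_lt hk⟩) :
    (descentTile w hk θ hd).IsRightPerimeter θ w := by
  refine ⟨k, hk, ?_, ?_⟩
  · rw [pathEdge, pathVertex_succ w (Nat.lt_of_succ_lt hk)]
    exact Or.inr (Or.inl rfl)
  · rw [pathEdge, pathVertex_succ w hk, pathVertex_succ w (Nat.lt_of_succ_lt hk)]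
    refine Or.inr (Or.inr (Or.inr ?_))
    rw [Set.mem_singleton_iff]
    congr 1
    simp only [descentTile]
    ring

theorem Tile.subset_carrier_of_mem_edges {t : Tile n} {E : Set ℂ} (hE : E ∈ t.edges θ) :
    E ⊆ t.carrier θ := by
  have h0 : t.top ∈ t.carrier θ := ⟨0, by simp, 0, by simp, by simp⟩
  have h1 : t.top + edgeVec θ t.lo ∈ t.carrier θ := ⟨1, by simp, 0, by simp, by simp⟩
  have h2 : t.top + edgeVec θ t.hi ∈ t.carrier θ := ⟨0, by simp, 1, by simp, by simp⟩
  have h3 : t.top + edgeVec θ t.lo + edgeVec θ t.hi ∈ t.carrier θ :=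
    ⟨1, by simp, 1, by simp, by simp⟩
  rcases hE with rfl | rfl | rfl | rfl
  exacts [t.convex_carrier.segment_subset h0 h1, t.convex_carrier.segment_subset h0 h2,
    t.convex_carrier.segment_subset h1 h3, t.convex_carrier.segment_subset h2 h3]

/-- Edges descend strictly, so a segment determines its top endpoint, then its drop and shift, and
the slope determines the label. -/
theorem eq_of_segment_eq (hθ : IsAdmissible θ) {p q : ℂ} {i j : Fin n}
    (h : segment ℝ p (p + edgeVec θ i) = segment ℝ q (q + edgeVec θ j)) : i = j := by
  have bounds : ∀ (p : ℂ) (i : Fin n), ∀ z ∈ segment ℝ p (p + edgeVec θ i),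
      p.im - drop θ i ≤ z.im ∧ z.im ≤ p.im ∧
      z.re = p.re + (p.im - z.im) / drop θ i * shift θ i := by
    intro p i z hz
    have hd := hθ.drop_pos i
    rw [segment_eq_image'] at hz
    obtain ⟨t, ⟨t0, t1⟩, rfl⟩ := hz
    have him : (p + t • (p + edgeVec θ i - p)).im = p.im - t * drop θ i := by simp [drop]
    rw [him]
    refine ⟨by nlinarith, by nlinarith, ?_⟩
    simp [shift]
    field_simp
    simp
  have h1 := bounds p i p (left_mem_segment _ _ _)
  have h2 := bounds q j p (h ▸ left_mem_segment _ _ _)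
  have h3 := bounds p i q (h ▸ left_mem_segment _ _ _)
  have hpq : p = q := by
    have him : p.im = q.im := le_antisymm h2.2.1 h3.2.1
    refine Complex.ext ?_ him
    rw [h2.2.2, him]; simp
  subst hpq
  have h4 := bounds p j (p + edgeVec θ i) (h ▸ right_mem_segment _ _ _)
  have h5 := bounds p i (p + edgeVec θ j) (h ▸ right_mem_segment _ _ _)
  have e1 : (p + edgeVec θ i).im = p.im - drop θ i := by simp [drop]
  have e2 : (p + edgeVec θ j).im = p.im - drop θ j := by simp [drop]
  rw [e1] at h4
  rw [e2] at h5
  have hdd : drop θ i = drop θ j := by linarith [h4.1, h5.1]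
  have hr := h4.2.2
  rw [← hdd, sub_sub_cancel, div_self (hθ.drop_pos i).ne', one_mul, Complex.add_re] at hr
  refine hθ.eq_of_slope_eq ?_
  rw [hdd]
  congr 1
  exact add_left_cancel hr

theorem label_mem_of_pathEdge_mem_edges (hθ : IsAdmissible θ) {w : Equiv.Perm (Fin n)} {k : ℕ}
    (hk : k < n) {t : Tile n} (h : pathEdge θ w k ∈ t.edges θ) : w ⟨k, hk⟩ ∈ t.labels := by
  rw [pathEdge, pathVertex_succ w hk] at h
  simp only [Tile.labels, mem_insert, mem_singleton]
  rcases h with h | h | h | h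
  · exact Or.inl (eq_of_segment_eq hθ h)
  · exact Or.inr (eq_of_segment_eq hθ h)
  · exact Or.inr (eq_of_segment_eq hθ h)
  · rw [add_right_comm] at h
    exact Or.inl (eq_of_segment_eq hθ h)

/-! ### Patterns -/

theorem not_togetherIn321_iff {w : Equiv.Perm (Fin n)} {k : ℕ} (hk : k + 1 < n) {x y : Fin n}
    (hx : w ⟨k, Nat.lt_of_succ_lt hk⟩ = x) (hy : w ⟨k + 1, hk⟩ = y) (hxy : y < x) :
    ¬ TogetherIn321 w x y ↔ IsLRMax w x ∧ IsRLMin w y := by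
  subst hx hy
  constructor
  · intro h
    refine ⟨⟨_, rfl, fun j hj => ?_⟩, ⟨_, rfl, fun j hj => ?_⟩⟩
    · by_contra! hle
      have hlt := lt_of_le_of_ne hle fun e => hj.ne' (w.injective e)
      exact h ⟨j, _, _, hj, by simp, hxy, hlt, by simp, by simp⟩
    · by_contra! hle
      have hlt := lt_of_le_of_ne hle fun e => hj.ne' (w.injective e)
      exact h ⟨_, _, j, by simp, hj, hlt, hxy, by simp, by simp⟩
  · rintro ⟨⟨i, hi, hmax⟩, ⟨j, hj, hmin⟩⟩ ⟨a, b, c, hab, hbc, hcb, hba, hxm, hym⟩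
    obtain rfl := w.injective hi
    obtain rfl := w.injective hj
    simp only [Set.mem_insert_iff, Set.mem_singleton_iff, EmbeddingLike.apply_eq_iff_eq] at hxm hym
    rcases hxm with hxm | hxm | hxm
    · rcases hym with hym | hym | hym
      · simp [← hxm] at hym
      · rw [hym] at hmin
        exact absurd (hmin c hbc) (not_lt.2 hcb.le)
      -- The positions `k` and `k + 1` leave no room for a middle entry of the pattern.
      · simp only [Fin.lt_def, Fin.ext_iff] at *
        omega
    · rw [hxm] at hmax
      exact absurd (hmax a hab) (not_lt.2 hba.le)
    · rw [hxm] at hmax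
      exact absurd (hmax b hbc) (not_lt.2 hcb.le)

theorem isLRMax_iff {w : Equiv.Perm (Fin n)} {k : Fin n} :
    IsLRMax w (w k) ↔ ∀ j : Fin n, j < k → w j < w k := by
  refine ⟨?_, fun h => ⟨k, rfl, h⟩⟩
  rintro ⟨i, hi, h⟩
  rwa [w.injective hi] at h

theorem isRLMin_iff {w : Equiv.Perm (Fin n)} {k : Fin n} :
    IsRLMin w (w k) ↔ ∀ j : Fin n, k < j → w k < w j := by
  refine ⟨?_, fun h => ⟨k, rfl, h⟩⟩
  rintro ⟨i, hi, h⟩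
  rwa [w.injective hi] at h

theorem hasForcedRightPerimeterTile_iff (hθ : IsAdmissible θ) {w : Equiv.Perm (Fin n)}
    (hw : FullySupported w) {k : ℕ} (hk : k + 1 < n)
    (hd : w ⟨k + 1, hk⟩ < w ⟨k, Nat.lt_of_succ_lt hk⟩) :
    HasForcedRightPerimeterTile θ w (w ⟨k, Nat.lt_of_succ_lt hk⟩) (w ⟨k + 1, hk⟩) ↔
      IsLRMax w (w ⟨k, Nat.lt_of_succ_lt hk⟩) ∧ IsRLMin w (w ⟨k + 1, hk⟩) := by
  have hn : 2 ≤ n := by omega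
  rw [isLRMax_iff, isRLMin_iff]
  constructor
  · rintro ⟨t, hlab, hforced⟩
    have hlohi : t.lo = w ⟨k + 1, hk⟩ ∧ t.hi = w ⟨k, Nat.lt_of_succ_lt hk⟩ := by
      have h1 : t.lo ∈ t.labels := by simp [Tile.labels]
      have h2 : t.hi ∈ t.labels := by simp [Tile.labels]
      have h3 := t.lo_lt_hi
      rw [hlab, mem_insert, mem_singleton] at h1 h2
      rcases h1 with h1 | h1 <;> rcases h2 with h2 | h2 <;> rw [h1, h2] at h3
      · exact absurd h3 (lt_irrefl _)
      · exact absurd h3 hd.asymm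
      · exact ⟨h1, h2⟩
      · exact absurd h3 (lt_irrefl _)
    obtain ⟨T, hT⟩ := exists_isWeakTiling hθ w
    obtain ⟨-, j, hj, hj1, hj2⟩ := hforced T (hT.isRhombicTiling hθ hw hn)
    -- Right-perimeter edges carry labels of the tile, so positions `j` and `j + 1` both lie in `{k,
    -- k + 1}`.
    have hjk : j = k := by
      have l1 := label_mem_of_pathEdge_mem_edges hθ (Nat.lt_of_succ_lt hj) hj1
      have l2 := label_mem_of_pathEdge_mem_edges hθ hj hj2
      rw [hlab] at l1 l2
      simp only [mem_insert, mem_singleton, EmbeddingLike.apply_eq_iff_eq, Fin.mk.injEq] at l1 l2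
      omega
    subst hjk
    have mid1 := Tile.subset_carrier_of_mem_edges hj1
      (edgeMid_mem_pathEdge hθ w (Nat.lt_of_succ_lt hk))
    have mid2 := Tile.subset_carrier_of_mem_edges hj2 (edgeMid_mem_pathEdge hθ w hk)
    constructor
    · intro i hi
      by_contra! hle
      have hlt := lt_of_le_of_ne hle fun e => hi.ne' (w.injective e)
      obtain ⟨T, hT, htT⟩ := exists_isWeakTiling_notMem_of_lt hθ _ w hlohi.2 mid1 i hi hlt
      exact htT (hforced T (hT.isRhombicTiling hθ hw hn)).1
    · intro i hi
      by_contra! hle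
      have hlt := lt_of_le_of_ne hle fun e => hi.ne' (w.injective e)
      obtain ⟨T, hT, htT⟩ :=
        exists_isWeakTiling_notMem_of_gt hθ _ w hlohi.1 mid2 i i.2 hi hlt
      exact htT (hforced T (hT.isRhombicTiling hθ hw hn)).1
  · rintro ⟨hmax, hmin⟩
    refine ⟨descentTile w hk θ hd, ?_, fun T hT => ⟨?_, descentTile_isRightPerimeter hd⟩⟩
    · exact pair_comm _ _
    · exact (hT.isWeakTiling hθ (by omega)).descentTile_mem hθ hk hd
        (fun j hj => hmax j hj) (fun j hj => hmin j hj)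

end Elnitsky

end

theorem theorem4 (n : ℕ) (θ : Fin n → ℝ) (hθ : Elnitsky.IsAdmissible θ)
    (w : Equiv.Perm (Fin n)) (hw : Elnitsky.FullySupported w)
    (k : ℕ) (hk : k + 1 < n) (x y : Fin n)
    (hx : w ⟨k, Nat.lt_of_succ_lt hk⟩ = x) (hy : w ⟨k + 1, hk⟩ = y) (hxy : y < x) :
    (Elnitsky.HasForcedRightPerimeterTile θ w x y ↔ ¬ Elnitsky.TogetherIn321 w x y) ∧
    (Elnitsky.HasForcedRightPerimeterTile θ w x y ↔
      Elnitsky.IsLRMax w x ∧ Elnitsky.IsRLMin w y) := by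
  rw [Elnitsky.not_togetherIn321_iff hk hx hy hxy, and_self]
  subst hx hy
  exact Elnitsky.hasForcedRightPerimeterTile_iff hθ hw hk hxy
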